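/- **Setting.** For each $n$ let $w^{(n)}=(w_1,\dots,w_n)$ be weights with $w_1\ge w_2\ge\dots\ge w_n>0$ (depending on $n$), and let $\ell_n=\sum_{i=1}^n w_i$. For $p\ge 0$ let $G(\mathbf W,p)$ be the random graph on $\{1,\dots,n\}$ in which each edge $\{i,j\}$ ($i\ne j$) is present, independently, with probability $1-e^{-w_iw_jp}$; equivalently, $\{i,j\}$ is present if and only if $E_{\{i,j\}}\le p$, where the $E_{\{i,j\}}$ are independent exponential variables of rates $w_iw_j$. Put $$p_{f}=\frac{\ell_n^{1/3}+f}{\ell_n^{4/3}} .$$ Let $W$ be a positive random variable. We say that the weights satisfy the *conditions with respect to $W$* if, as $n\to\infty$, 1. the law of a uniformly chosen weight, $\frac1n\sum_{i=1}^n\delta_{w_i}$, converges weakly to the law of $W$; 2. $\mathbb E[W^3]<\infty$; 3. $\mathbb E[W^2]=\mathbb E[W]$; 4. $\ell_n=\mathbb E[W]\,n+o(n^{2/3})$; 5. $\sum_{k=1}^n w_k^2=\mathbb E[W^2]\,n+o(n^{2/3})$; 6. $\sum_{k=1}^n w_k^3=\mathbb E[W^3]\,n+o(n)$; 7. $\max_{i\le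 n}w_i=o(n^{1/3})$. The excess (surplus) of a connected component is the number of edges that have to be removed from it in order to make it a tree. A largest component is one with the maximal number of vertices. **Theorem (the excess of the giant component).** For every law of $W$ there is a constant $A>0$, depending only on this law, such that the following holds. Let the weights satisfy the conditions with respect to $W$, and let $(f_n)$ be a sequence of positive real numbers with $f_n=o(n^{1/3})$. Then for all $n$ large enough (how large may depend on the weights and on the sequence $(f_n)$), $$\mathbb P\bigl(\text{some largest connected component of } G(\mathbf W,p_{f_n})\text{ has excess}\ge A f_n^3\bigr)\le A\exp\left(-\frac{f_n}{A}\right).$$ -/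

import Mathlib

open MeasureTheory ProbabilityTheory Filter Topology Asymptotics
open scoped BoundedContinuousFunction

namespace RankOneGraph

noncomputable section

/-- The potential edges on the vertex set `Fin n`: unordered pairs of distinct vertices. -/
abbrev PotentialEdge (n : ℕ) : Type := {e : Sym2 (Fin n) // ¬ e.IsDiag}

/-- The rate `w i * w j` attached to the potential edge `{i, j}`. -/
def edgeRate {n : ℕ} (w : Fin n → ℝ) (e : PotentialEdge n) : ℝ := (e.1.map w).mul

/-- The joint law of the edge capacities: independent exponential variables, the capacity of the
edge `{i, j}` having rate `w i * w j`. -/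
def capacityLaw {n : ℕ} (w : Fin n → ℝ) : Measure (PotentialEdge n → ℝ) :=
  Measure.pi fun e => expMeasure (edgeRate w e)

/-- The graph whose edges are the potential edges of capacity at most `p`.  Under `capacityLaw w`
this is the rank-1 inhomogeneous random graph with weights `w` and parameter `p`: for `0 ≤ p` each
edge `{i, j}` is present with probability `1 - exp (-(w i * w j * p))`, independently. -/
def graphAt {n : ℕ} (E : PotentialEdge n → ℝ) (p : ℝ) : SimpleGraph (Fin n) :=
  SimpleGraph.fromEdgeSet {e | ∃ h : ¬ e.IsDiag, E ⟨e, h⟩ ≤ p}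

/-- The total weight `ℓ_n`. -/
def totalWeight {n : ℕ} (w : Fin n → ℝ) : ℝ := ∑ i, w i

/-- The parameter `p_f = (ℓ_n ^ (1/3) + f) / ℓ_n ^ (4/3)`. -/
def critParam {n : ℕ} (w : Fin n → ℝ) (f : ℝ) : ℝ :=
  (totalWeight w ^ (1 / 3 : ℝ) + f) / totalWeight w ^ (4 / 3 : ℝ)

/-- The excess (surplus) of a finite connected graph: the number of edges that have to be removed
from it in order to make it a tree. -/
def excess {V : Type*} (H : SimpleGraph V) : ℕ :=
  sInf {k | ∃ s : Set (Sym2 V), s ⊆ H.edgeSet ∧ s.ncard = k ∧ (H.deleteEdges s).IsTree}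

/-- A connected component is a largest one if no component has more vertices. -/
def IsLargest {V : Type*} {G : SimpleGraph V} (c : G.ConnectedComponent) : Prop :=
  ∀ c' : G.ConnectedComponent, c'.supp.ncard ≤ c.supp.ncard

/-- The conditions on the weights `w n 0 ≥ w n 1 ≥ ... ≥ w n (n - 1) > 0` (one vector for each
`n`), with respect to the law `μ` of a positive random variable `W`. -/
structure WeightConditions (μ : Measure ℝ) (w : (n : ℕ) → Fin n → ℝ) : Prop where
  weight_pos : ∀ n i, 0 < w n i
  weight_antitone : ∀ n, Antitone (w n)
  law_pos : ∀ᵐ x ∂μ, 0 < x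
  /-- A uniformly chosen weight converges weakly to `W`. -/
  tendsto_law : ∀ g : ℝ →ᵇ ℝ,
    Tendsto (fun n : ℕ => (∑ i, g (w n i)) / (n : ℝ)) atTop (𝓝 (∫ x, g x ∂μ))
  integrable_cube : Integrable (fun x : ℝ => x ^ 3) μ
  second_moment_eq : ∫ x, x ^ 2 ∂μ = ∫ x, x ∂μ
  sum_weight : (fun n : ℕ => totalWeight (w n) - (∫ x, x ∂μ) * n)
    =o[atTop] fun n : ℕ => (n : ℝ) ^ (2 / 3 : ℝ)
  sum_weight_sq : (fun n : ℕ => ∑ i, w n i ^ 2 - (∫ x, x ^ 2 ∂μ) * n)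
    =o[atTop] fun n : ℕ => (n : ℝ) ^ (2 / 3 : ℝ)
  sum_weight_cube : (fun n : ℕ => ∑ i, w n i ^ 3 - (∫ x, x ^ 3 ∂μ) * n)
    =o[atTop] fun n : ℕ => (n : ℝ)
  max_weight : (fun n : ℕ => ⨆ i, w n i) =o[atTop] fun n : ℕ => (n : ℝ) ^ (1 / 3 : ℝ)

end

end RankOneGraph

/-! Maximality of the component plays no role: with high probability no component at all has excess
of order `f ^ 3`. Put ε = ℓ^(-1/3), so that p = ε³(1 + fε). The deterministic information used about
the weights is collected in `CriticalWindow`.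

The graph is explored from a set Q of active vertices, U being the unseen ones. An active vertex v
is removed and its edges are revealed: those to U discover vertices, those to Q are surplus edges.
Estimates for this process are supermartingale arguments, run by `gexp_le_of_step`; a single step
involves only independent indicators, whose exponential moments are `bexp_exp_card_le` and
`bexp_exp_sum_le`.

In `gexp_hasExcess_univ_le` the exploration starts from a set Q of weight of order f²/ε. By
`HasExcess.extra_or_unreached`, a component of large excess either meets Q, and then `extra` is
large, or lies in the unreached part. Per unit of explored weight, the active weight drifts by about
p ∑_U w² - 1. This is at most 3fε, and it falls as vertices are discovered, because the third moment
over U stays bounded below (`le_p_mul_sum_cube`).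

For the reached part (`gexp_extra_le`), the active weight stays of order f²/ε, so surplus edges
appear at rate of order f²ε² per unit of weight, while the explored weight is of order f/ε²; the
total is f³. An exponential potential in the active weight and in the remaining second moment makes
this quantitative (`potential_step_le`).

For the unreached part (`gexp_hasExcess_unreached_le`), so many initial roots make it unlikely that
the exploration dies before p ∑_U w² ≤ 1 - 3fε. What remains is then a subcritical graph. There
`gexp_hasExcess_le` bounds the probability of a component of excess at least 20f, by a weighted sum
over starting vertices, split dyadically according to the weight of the component.

Finally `capacityLaw_hasExcess_le` and `hasExcess_presentEdges` transfer the bound to the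
exponential capacities, and bounded f is absorbed by the constant. -/

namespace RankOneGraph

noncomputable section

/-! ### Expectations of independent Bernoulli families -/

section Bernoulli

variable {ι κ : Type*} [DecidableEq ι] [DecidableEq κ]

/-- The expectation of `F S`, where `S` is the random subset of `A` that contains each `e ∈ A`
independently with probability `q e`. -/
def bexp (q : ι → ℝ) (A : Finset ι) (F : Finset ι → ℝ) : ℝ :=
  ∑ S ∈ A.powerset, ((∏ e ∈ S, q e) * ∏ e ∈ A \ S, (1 - q e)) * F S

variable {q : ι → ℝ} {A B : Finset ι} {F G : Finset ι → ℝ}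

lemma bexp_weight_nonneg (h0 : ∀ e, 0 ≤ q e) (h1 : ∀ e, q e ≤ 1) (S : Finset ι) :
    0 ≤ (∏ e ∈ S, q e) * ∏ e ∈ A \ S, (1 - q e) :=
  mul_nonneg (Finset.prod_nonneg fun e _ => h0 e)
    (Finset.prod_nonneg fun e _ => sub_nonneg.2 (h1 e))

lemma bexp_congr (h : ∀ S ⊆ A, F S = G S) : bexp q A F = bexp q A G :=
  Finset.sum_congr rfl fun S hS => by rw [h S (Finset.mem_powerset.1 hS)]

lemma bexp_mono (h0 : ∀ e, 0 ≤ q e) (h1 : ∀ e, q e ≤ 1) (h : ∀ S ⊆ A, F S ≤ G S) :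
    bexp q A F ≤ bexp q A G :=
  Finset.sum_le_sum fun S hS =>
    mul_le_mul_of_nonneg_left (h S (Finset.mem_powerset.1 hS)) (bexp_weight_nonneg h0 h1 S)

lemma bexp_add : bexp q A (fun S => F S + G S) = bexp q A F + bexp q A G := by
  simp [bexp, mul_add, Finset.sum_add_distrib]

lemma bexp_mul_left (c : ℝ) : bexp q A (fun S => c * F S) = c * bexp q A F := by
  simp only [bexp, Finset.mul_sum]
  exact Finset.sum_congr rfl fun S _ => by ring

lemma bexp_sum {α : Type*} (s : Finset α) (H : α → Finset ι → ℝ) :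
    bexp q A (fun S => ∑ a ∈ s, H a S) = ∑ a ∈ s, bexp q A (H a) := by
  simp only [bexp, Finset.mul_sum]
  exact Finset.sum_comm

/-- Independence: the expectation of a product over the chosen elements factorizes. -/
lemma bexp_prod (x : ι → ℝ) :
    bexp q A (fun S => ∏ e ∈ S, x e) = ∏ e ∈ A, (1 + q e * (x e - 1)) := by
  have := Finset.prod_add (fun e => q e * x e) (fun e => 1 - q e) A
  calc _ = ∑ t ∈ A.powerset, (∏ i ∈ t, q i * x i) * ∏ i ∈ A \ t, (1 - q i) :=
        Finset.sum_congr rfl fun S _ => by rw [Finset.prod_mul_distrib]; ring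
    _ = _ := by rw [← this]; exact Finset.prod_congr rfl fun e _ => by ring

lemma bexp_const (c : ℝ) : bexp q A (fun _ => c) = c := by
  have h := bexp_prod (q := q) (A := A) (fun _ => 1)
  have h2 := bexp_mul_left (q := q) (A := A) (F := fun _ => 1) c
  simp only [Finset.prod_const_one, sub_self, mul_zero, add_zero] at h
  simpa [h] using h2

lemma bexp_insert {a : ι} (ha : a ∉ A) :
    bexp q (insert a A) F =
      (1 - q a) * bexp q A F + q a * bexp q A (fun S => F (insert a S)) := by
  unfold bexp
  rw [Finset.sum_powerset_insert ha, Finset.mul_sum, Finset.mul_sum]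
  congr 1
  · refine Finset.sum_congr rfl fun S hS => ?_
    have haS : a ∉ S := fun h => ha (Finset.mem_powerset.1 hS h)
    rw [Finset.insert_sdiff_of_notMem _ haS, Finset.prod_insert (by simp [ha])]
    ring
  · refine Finset.sum_congr rfl fun S hS => ?_
    have haS : a ∉ S := fun h => ha (Finset.mem_powerset.1 hS h)
    rw [Finset.prod_insert haS, Finset.insert_sdiff_insert,
      Finset.sdiff_insert_of_notMem ha]
    ring

lemma bexp_union (h : Disjoint A B) :
    bexp q (A ∪ B) F = bexp q A (fun S => bexp q B fun T => F (S ∪ T)) := by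
  induction A using Finset.induction_on generalizing F with
  | empty => simp [bexp]
  | insert a A ha ih =>
    rw [Finset.disjoint_insert_left] at h
    rw [Finset.insert_union, bexp_insert (by simp [ha, h.1]), bexp_insert ha, ih h.2, ih h.2]
    simp only [Finset.insert_union]

lemma bexp_image {q : κ → ℝ} {F : Finset κ → ℝ} (g : ι → κ) (hg : Function.Injective g) :
    bexp q (A.image g) F = bexp (fun i => q (g i)) A (fun T => F (T.image g)) := by
  induction A using Finset.induction_on generalizing F with
  | empty => simp [bexp]
  | insert a A ha ih =>
    rw [Finset.image_insert, bexp_insert (by simpa [hg.eq_iff] using ha), bexp_insert ha, ih, ih]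
    simp only [Finset.image_insert]

end Bernoulli

/-! ### Edge sets: complete graphs and stars. -/

section EdgesIn

lemma mk_right_injective {W : Type*} (v : W) : Function.Injective fun j : W => s(v, j) :=
  fun _ _ h => Sym2.congr_right.1 h

variable {V : Type*} [DecidableEq V]

/-- The potential edges with both ends in `X`. -/
def edgesIn (X : Finset V) : Finset (Sym2 V) := X.sym2.filter fun e => ¬ e.IsDiag

lemma mk_mem_edgesIn {X : Finset V} {x y : V} :
    s(x, y) ∈ edgesIn X ↔ x ∈ X ∧ y ∈ X ∧ x ≠ y := by
  simp [edgesIn, and_assoc]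

lemma edgesIn_mono {X Y : Finset V} (h : X ⊆ Y) : edgesIn X ⊆ edgesIn Y :=
  Finset.filter_subset_filter _ (Finset.sym2_mono h)

/-- The edges from `v` to `T`. -/
def star (v : V) (T : Finset V) : Finset (Sym2 V) := T.image fun j => s(v, j)

lemma mk_mem_star {v : V} {T : Finset V} {x y : V} :
    s(x, y) ∈ star v T ↔ (x = v ∧ y ∈ T) ∨ (y = v ∧ x ∈ T) := by
  simp only [star, Finset.mem_image, Sym2.eq_iff]
  constructor
  · rintro ⟨j, hj, ⟨rfl, rfl⟩ | ⟨rfl, rfl⟩⟩ <;> simp [hj]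
  · rintro (⟨rfl, h⟩ | ⟨rfl, h⟩)
    · exact ⟨y, h, by simp⟩
    · exact ⟨x, h, by simp⟩

lemma edgesIn_insert {v : V} {Y : Finset V} (hv : v ∉ Y) :
    edgesIn (insert v Y) = star v Y ∪ edgesIn Y := by
  ext e
  induction e with | h x y =>
  simp only [mk_mem_edgesIn, Finset.mem_union, mk_mem_star, Finset.mem_insert]
  grind

lemma disjoint_star_edgesIn {v : V} {Y T : Finset V} (hv : v ∉ Y) :
    Disjoint (star v T) (edgesIn Y) := by
  rw [Finset.disjoint_left]
  intro e
  induction e with | h x y =>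
  simp only [mk_mem_edgesIn, mk_mem_star]
  grind

/-- Exposing the edges at `v` first. -/
lemma bexp_edgesIn_insert {q : Sym2 V → ℝ} {F : Finset (Sym2 V) → ℝ} {v : V} {Y : Finset V}
    (hv : v ∉ Y) :
    bexp q (edgesIn (insert v Y)) F =
      bexp (fun j => q s(v, j)) Y fun T => bexp q (edgesIn Y) fun S => F (star v T ∪ S) := by
  rw [edgesIn_insert hv, bexp_union (disjoint_star_edgesIn hv), star,
    bexp_image _ (mk_right_injective v)]
  rfl

end EdgesIn

/-! ### Exploring a graph -/

section Exploration

variable {V : Type*} [DecidableEq V]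

/-- `C` is a union of components of the graph with edge set `S` on the vertex set `X`. -/
def IsClosedIn (S : Finset (Sym2 V)) (X C : Finset V) : Prop :=
  C ⊆ X ∧ ∀ x ∈ C, ∀ y ∈ X, s(x, y) ∈ S → y ∈ C

open Classical in
/-- The vertices of `U` that are not connected to `Q` in the graph on `Q ∪ U`. -/
def unreached (S : Finset (Sym2 V)) (Q U : Finset V) : Finset V :=
  U.filter fun u => ∃ C ⊆ U, IsClosedIn S (Q ∪ U) C ∧ u ∈ C

/-- The number of edges of `S` inside `X`. -/
def edgeCount (S : Finset (Sym2 V)) (X : Finset V) : ℕ := (S ∩ edgesIn X).card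

/-- The number of edges, beyond those of a spanning forest rooted at `Q`, in the part of the graph
on `Q ∪ U` that is connected to `Q`. -/
def extra (S : Finset (Sym2 V)) (Q U : Finset V) : ℝ :=
  edgeCount S ((Q ∪ U) \ unreached S Q U) - ((U \ unreached S Q U).card : ℝ)

/-- The total weight of the vertices that are connected to `Q` in the graph on `Q ∪ U`. -/
def reachedMass (w : V → ℝ) (S : Finset (Sym2 V)) (Q U : Finset V) : ℝ :=
  ∑ i ∈ Q, w i + ∑ i ∈ U \ unreached S Q U, w i

/-- `C` is a component of the graph with edge set `S` on the vertex set `X`. -/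
def IsComponent (S : Finset (Sym2 V)) (X C : Finset V) : Prop :=
  C.Nonempty ∧ IsClosedIn S X C ∧ ∀ D, D ⊆ C → IsClosedIn S X D → D = ∅ ∨ D = C

/-- Some component of the graph with edge set `S` on the vertex set `X` has excess at least `k`. -/
def HasExcess (S : Finset (Sym2 V)) (X : Finset V) (k : ℝ) : Prop :=
  ∃ C, IsComponent S X C ∧ k + C.card ≤ edgeCount S C + 1

variable {S : Finset (Sym2 V)} {Q U X C D T : Finset V} {v : V} {w : V → ℝ} {k : ℝ}

lemma mem_unreached {u : V} :
    u ∈ unreached S Q U ↔ ∃ C ⊆ U, IsClosedIn S (Q ∪ U) C ∧ u ∈ C := by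
  classical
  simp only [unreached, Finset.mem_filter]
  exact ⟨fun h => h.2, fun ⟨C, h1, h2, h3⟩ => ⟨h1 h3, C, h1, h2, h3⟩⟩

lemma unreached_subset : unreached S Q U ⊆ U := fun _ hu =>
  let ⟨_, h1, _, h3⟩ := mem_unreached.1 hu
  h1 h3

lemma subset_unreached (hC : C ⊆ U) (h : IsClosedIn S (Q ∪ U) C) : C ⊆ unreached S Q U :=
  fun _ hu => mem_unreached.2 ⟨C, hC, h, hu⟩

lemma isClosedIn_unreached : IsClosedIn S (Q ∪ U) (unreached S Q U) := by
  refine ⟨unreached_subset.trans Finset.subset_union_right, fun x hx y hy hxy => ?_⟩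
  obtain ⟨C, hCU, hC, hxC⟩ := mem_unreached.1 hx
  exact subset_unreached hCU hC (hC.2 x hxC y hy hxy)

lemma IsClosedIn.inter (hC : IsClosedIn S X C) (hD : IsClosedIn S X D) :
    IsClosedIn S X (C ∩ D) :=
  ⟨Finset.inter_subset_left.trans hC.1, fun x hx y hy h => Finset.mem_inter.2
    ⟨hC.2 x (Finset.mem_inter.1 hx).1 y hy h, hD.2 x (Finset.mem_inter.1 hx).2 y hy h⟩⟩

lemma IsClosedIn.compl (hC : IsClosedIn S X C) : IsClosedIn S X (X \ C) := by
  refine ⟨Finset.sdiff_subset, fun x hx y hy h => Finset.mem_sdiff.2 ⟨hy, fun hyC => ?_⟩⟩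
  obtain ⟨h1, h2⟩ := Finset.mem_sdiff.1 hx
  exact h2 (hC.2 y hyC x h1 (by rwa [Sym2.eq_swap]))

lemma notMem_of_subset_edgesIn (hS : S ⊆ edgesIn X) (hv : v ∉ X) (x : V) : s(x, v) ∉ S :=
  fun h => hv (mk_mem_edgesIn.1 (hS h)).2.1

lemma union_step (Q U T : Finset V) : (Q ∪ U ∩ T) ∪ U \ T = Q ∪ U := by
  grind

/-- A closed set meeting T would have to contain v, which lies outside U. Conversely, once T is
avoided, no edge at v meets C. -/
lemma isClosedIn_star_iff (hv : v ∉ Q ∪ U) (hS : S ⊆ edgesIn (Q ∪ U)) (hC : C ⊆ U) :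
    IsClosedIn (star v T ∪ S) (insert v Q ∪ U) C ↔
      C ⊆ U \ T ∧ IsClosedIn S (Q ∪ U) C := by
  have hvC : v ∉ C := fun h => hv (Finset.mem_union_right _ (hC h))
  constructor
  · rintro ⟨_, h2⟩
    refine ⟨fun x hx => Finset.mem_sdiff.2 ⟨hC hx, fun hxT => hvC (h2 x hx v (by simp) ?_)⟩,
      hC.trans Finset.subset_union_right, fun x hx y hy hxy => h2 x hx y ?_ ?_⟩
    · exact Finset.mem_union_left _ (mk_mem_star.2 (Or.inr ⟨rfl, hxT⟩))
    · rw [Finset.insert_union]; exact Finset.mem_insert_of_mem hy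
    · exact Finset.mem_union_right _ hxy
  · rintro ⟨h1, _, h2⟩
    refine ⟨hC.trans Finset.subset_union_right, fun x hx y hy hxy => ?_⟩
    rw [Finset.mem_union, mk_mem_star] at hxy
    rcases hxy with (⟨rfl, _⟩ | ⟨rfl, hxT⟩) | hxy
    · exact absurd hx hvC
    · exact absurd hxT (Finset.mem_sdiff.1 (h1 hx)).2
    · rw [Finset.insert_union, Finset.mem_insert] at hy
      rcases hy with rfl | hy
      · exact absurd hxy (notMem_of_subset_edgesIn hS hv x)
      · exact h2 x hx y hy hxy

/-- The Markov property of the exploration: after v is processed, the state (Q, U) becomes (Q ∪ U ∩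
T, U \ T), and the remaining edge set S no longer involves v. -/
lemma unreached_star (hv : v ∉ Q ∪ U) (hS : S ⊆ edgesIn (Q ∪ U)) :
    unreached (star v T ∪ S) (insert v Q) U = unreached S (Q ∪ U ∩ T) (U \ T) := by
  ext u
  rw [mem_unreached, mem_unreached, union_step]
  constructor
  · rintro ⟨C, hCU, hC, hu⟩
    rw [isClosedIn_star_iff hv hS hCU] at hC
    exact ⟨C, hC.1, hC.2, hu⟩
  · rintro ⟨C, hCU, hC, hu⟩
    have hCU' := hCU.trans Finset.sdiff_subset
    exact ⟨C, hCU', (isClosedIn_star_iff hv hS hCU').2 ⟨hCU, hC⟩, hu⟩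

lemma edgeCount_star (hv : v ∉ Q ∪ U) (hS : S ⊆ edgesIn (Q ∪ U)) (hX : X ⊆ Q ∪ U) :
    edgeCount (star v T ∪ S) (insert v X) = (X ∩ T).card + edgeCount S X := by
  have hvX : v ∉ X := fun h => hv (hX h)
  have : (star v T ∪ S) ∩ edgesIn (insert v X) = star v (X ∩ T) ∪ S ∩ edgesIn X := by
    ext e
    induction e with | h x y =>
    have h1 := notMem_of_subset_edgesIn hS hv x
    have h2 := notMem_of_subset_edgesIn hS hv y
    rw [Sym2.eq_swap] at h2
    simp only [Finset.mem_inter, Finset.mem_union, mk_mem_star, mk_mem_edgesIn, Finset.mem_insert]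
    grind
  rw [edgeCount, edgeCount, this, Finset.card_union_of_disjoint, star,
    Finset.card_image_of_injective _ (mk_right_injective v)]
  exact (disjoint_star_edgesIn hvX).mono_right Finset.inter_subset_right

lemma edgeCount_star_of_notMem (hvX : v ∉ X) :
    edgeCount (star v T ∪ S) X = edgeCount S X := by
  rw [edgeCount, edgeCount, Finset.union_inter_distrib_right,
    (Finset.disjoint_iff_inter_eq_empty.1 (disjoint_star_edgesIn hvX)), Finset.empty_union]

lemma sdiff_unreached_star (hv : v ∉ Q ∪ U) (hS : S ⊆ edgesIn (Q ∪ U)) :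
    U \ unreached (star v T ∪ S) (insert v Q) U =
      U ∩ T ∪ (U \ T) \ unreached S (Q ∪ U ∩ T) (U \ T) := by
  rw [unreached_star hv hS]
  have := unreached_subset (S := S) (Q := Q ∪ U ∩ T) (U := U \ T)
  grind

/-- Each edge from v to `U ∩ T` is paid for by the vertex it discovers, so only the edges back to
the active set count. -/
lemma extra_star (hv : v ∉ Q ∪ U) (hQU : Disjoint Q U) (hS : S ⊆ edgesIn (Q ∪ U)) :
    extra (star v T ∪ S) (insert v Q) U =
      (Q ∩ T).card + extra S (Q ∪ U ∩ T) (U \ T) := by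
  have hR := unreached_subset (S := S) (Q := Q ∪ U ∩ T) (U := U \ T)
  rw [extra, extra, sdiff_unreached_star hv hS, unreached_star hv hS, union_step]
  set R := unreached S (Q ∪ U ∩ T) (U \ T)
  have hvR : v ∉ R := fun h => hv (Finset.mem_union_right _ (Finset.sdiff_subset (hR h)))
  have h1 : (insert v Q ∪ U) \ R = insert v ((Q ∪ U) \ R) := by
    rw [Finset.insert_union, Finset.insert_sdiff_of_notMem _ hvR]
  have h2 : ((Q ∪ U) \ R) ∩ T = Q ∩ T ∪ U ∩ T := by
    have : Disjoint R Q := (hQU.symm.mono_left (hR.trans Finset.sdiff_subset))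
    rw [Finset.disjoint_left] at this
    grind
  rw [h1, edgeCount_star hv hS Finset.sdiff_subset, h2, Finset.card_union_of_disjoint,
    Finset.card_union_of_disjoint]
  · push_cast; ring
  · rw [Finset.disjoint_left]; grind
  · exact hQU.mono Finset.inter_subset_left Finset.inter_subset_left

lemma reachedMass_star (hv : v ∉ Q ∪ U) (hQU : Disjoint Q U) (hS : S ⊆ edgesIn (Q ∪ U)) :
    reachedMass w (star v T ∪ S) (insert v Q) U =
      w v + reachedMass w S (Q ∪ U ∩ T) (U \ T) := by
  rw [reachedMass, reachedMass, sdiff_unreached_star hv hS, Finset.sum_union, Finset.sum_union,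
    Finset.sum_insert]
  · ring
  · exact fun h => hv (Finset.mem_union_left _ h)
  · exact hQU.mono_right Finset.inter_subset_left
  · rw [Finset.disjoint_left]; grind

lemma isClosedIn_congr {S' : Finset (Sym2 V)} (h : S ∩ edgesIn X = S' ∩ edgesIn X) :
    IsClosedIn S X C ↔ IsClosedIn S' X C := by
  have key : ∀ {S S' : Finset (Sym2 V)}, S ∩ edgesIn X = S' ∩ edgesIn X →
      IsClosedIn S X C → IsClosedIn S' X C := by
    rintro S S' h ⟨h1, h2⟩
    refine ⟨h1, fun x hx y hy hxy => ?_⟩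
    by_cases hne : x = y
    · rwa [← hne]
    · have : s(x, y) ∈ S' ∩ edgesIn X :=
        Finset.mem_inter.2 ⟨hxy, mk_mem_edgesIn.2 ⟨h1 hx, hy, hne⟩⟩
      rw [← h] at this
      exact h2 x hx y hy (Finset.mem_inter.1 this).1
  exact ⟨key h, key h.symm⟩

lemma hasExcess_congr {S' : Finset (Sym2 V)} (h : S ∩ edgesIn X = S' ∩ edgesIn X) :
    HasExcess S X k ↔ HasExcess S' X k := by
  have key : ∀ {S S' : Finset (Sym2 V)}, S ∩ edgesIn X = S' ∩ edgesIn X →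
      HasExcess S X k → HasExcess S' X k := by
    rintro S S' h ⟨C, ⟨hne, hC, hmin⟩, hk⟩
    refine ⟨C, ⟨hne, (isClosedIn_congr h).1 hC, fun D hDC hD =>
      hmin D hDC ((isClosedIn_congr h).2 hD)⟩, ?_⟩
    have : S ∩ edgesIn C = S' ∩ edgesIn C := by
      have hCX := edgesIn_mono hC.1
      ext e
      have := Finset.ext_iff.1 h e
      simp only [Finset.mem_inter] at this ⊢
      exact ⟨fun he => ⟨(this.1 ⟨he.1, hCX he.2⟩).1, he.2⟩,
        fun he => ⟨(this.2 ⟨he.1, hCX he.2⟩).1, he.2⟩⟩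
    rwa [edgeCount, ← this]
  exact ⟨key h, key h.symm⟩

lemma hasExcess_star (hvX : v ∉ X) : HasExcess (star v T ∪ S) X k ↔ HasExcess S X k :=
  hasExcess_congr <| by
    rw [Finset.union_inter_distrib_right,
      (Finset.disjoint_iff_inter_eq_empty.1 (disjoint_star_edgesIn hvX)), Finset.empty_union]

lemma exists_eq_star_union (hS : S ⊆ edgesIn (insert v X)) :
    ∃ T ⊆ X, ∃ S' ⊆ edgesIn X, S = star v T ∪ S' := by
  refine ⟨X.filter fun j => s(v, j) ∈ S, Finset.filter_subset _ _, S ∩ edgesIn X,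
    Finset.inter_subset_right, ?_⟩
  ext e
  induction e with | h x y =>
  have h1 := @hS s(x, y)
  have h2 : s(x, y) = s(y, x) := Sym2.eq_swap
  simp only [Finset.mem_inter, Finset.mem_union, mk_mem_star, mk_mem_edgesIn, Finset.mem_filter,
    Finset.mem_insert] at h1 ⊢
  grind

/-- A union of components that is connected to `Q` has at most as many edges as the forest
structure of the exploration allows. -/
lemma edgeCount_add_le_extra {m : ℕ} : ∀ {S : Finset (Sym2 V)} {Q U C : Finset V},
    (Q ∪ U).card = m → Disjoint Q U → S ⊆ edgesIn (Q ∪ U) → IsClosedIn S (Q ∪ U) C →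
    Disjoint C (unreached S Q U) →
    (edgeCount S C : ℝ) + (Q ∩ C).card ≤ C.card + extra S Q U := by
  induction m with
  | zero =>
    intro S Q U C hm _ hS hC _
    rw [Finset.card_eq_zero] at hm
    have hC0 : C = ∅ := Finset.subset_empty.1 (hm ▸ hC.1)
    have hU : U = ∅ := (Finset.union_eq_empty.1 hm).2
    subst hC0 hU
    simp [edgeCount, extra, edgesIn]
  | succ m ih =>
    intro S Q U C hm hQU hS hC hdis
    rcases Q.eq_empty_or_nonempty with rfl | ⟨v, hvQ⟩
    · have hU : unreached S ∅ U = U :=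
        unreached_subset.antisymm (subset_unreached subset_rfl
          ⟨by simp, fun _ _ y hy _ => by simpa using hy⟩)
      have hC0 : C = ∅ := by
        rw [hU] at hdis
        have h2 : C ⊆ U := by simpa using hC.1
        exact Finset.disjoint_self_iff_empty C |>.1 (hdis.mono_right h2)
      subst hC0
      simp [edgeCount, extra, hU, edgesIn]
    · obtain ⟨Q, hvQ1, rfl⟩ : ∃ Q1, v ∉ Q1 ∧ insert v Q1 = Q :=
        ⟨Q.erase v, by simp, Finset.insert_erase hvQ⟩
      rw [Finset.disjoint_insert_left] at hQU
      have hv : v ∉ Q ∪ U := by simp [hvQ1, hQU.1]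
      rw [Finset.insert_union] at hS
      obtain ⟨T, hT, S, hS', rfl⟩ := exists_eq_star_union hS
      rw [unreached_star hv hS'] at hdis
      rw [extra_star hv hQU.2 hS']
      have hm' : (Q ∪ U).card = m := by
        rw [Finset.insert_union, Finset.card_insert_of_notMem hv] at hm
        omega
      have hCv : IsClosedIn S (Q ∪ U) (C.erase v) := by
        refine ⟨fun x hx => ?_, fun x hx y hy hxy => ?_⟩
        · have := hC.1 (Finset.mem_of_mem_erase hx)
          rw [Finset.insert_union, Finset.mem_insert] at this
          exact this.resolve_left (Finset.ne_of_mem_erase hx)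
        · refine Finset.mem_erase.2 ⟨fun h => hv (h ▸ hy), hC.2 x (Finset.mem_of_mem_erase hx) y ?_ ?_⟩
          · rw [Finset.insert_union]; exact Finset.mem_insert_of_mem hy
          · exact Finset.mem_union_right _ hxy
      have key := @ih S (Q ∪ U ∩ T) (U \ T) (C.erase v) (by rwa [union_step])
        (by have := hQU.2; rw [Finset.disjoint_left] at this ⊢; grind) (by rwa [union_step])
        (by rwa [union_step]) (hdis.mono_left (Finset.erase_subset _ _))
      -- A closed set contains v together with all its neighbours, or none of them.
      have hadj : ∀ j ∈ T, j ∈ C ↔ v ∈ C := by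
        intro j hj
        have hjX : j ∈ insert v Q ∪ U := by
          rw [Finset.insert_union]; exact Finset.mem_insert_of_mem (hT hj)
        constructor
        · intro h
          exact hC.2 j h v (by simp) (Finset.mem_union_left _ (mk_mem_star.2 (Or.inr ⟨rfl, hj⟩)))
        · intro h
          exact hC.2 v h j hjX (Finset.mem_union_left _ (mk_mem_star.2 (Or.inl ⟨rfl, hj⟩)))
      -- If v ∈ C, all edges at v lie in C: those to U are balanced by the new roots in the
      -- induction hypothesis, those to Q by the new term of `extra`. If v ∉ C, that term is
      -- nonnegative slack.
      by_cases hvC : v ∈ C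
      · obtain ⟨D, hvD, rfl⟩ : ∃ D, v ∉ D ∧ insert v D = C :=
          ⟨C.erase v, by simp, Finset.insert_erase hvC⟩
        rw [Finset.erase_insert hvD] at key hCv
        rw [edgeCount_star hv hS' hCv.1, Finset.card_insert_of_notMem hvD,
          Finset.insert_inter_of_mem (by simp), Finset.inter_insert_of_notMem hvQ1,
          Finset.card_insert_of_notMem (by simp [hvD])]
        have e1 : (D ∩ T).card = (Q ∩ T).card + (U ∩ T).card := by
          rw [← Finset.card_union_of_disjoint
            (hQU.2.mono Finset.inter_subset_left Finset.inter_subset_left)]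
          congr 1
          ext j
          have := hadj j
          have := @hT j
          have := @hT v
          grind
        have e2 : ((Q ∪ U ∩ T) ∩ D).card = (Q ∩ D).card + (U ∩ T).card := by
          rw [Finset.union_inter_distrib_right, Finset.card_union_of_disjoint]
          · congr 2
            ext j
            have := hadj j
            have := @hT j
            have := @hT v
            grind
          · exact hQU.2.mono Finset.inter_subset_left
              (Finset.inter_subset_left.trans Finset.inter_subset_left)
        rw [e2] at key
        rw [e1]
        push_cast at key ⊢
        linarith
      · rw [Finset.erase_eq_of_notMem hvC] at key hCv
        rw [edgeCount_star_of_notMem hvC, Finset.insert_inter_of_notMem hvC]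
        have e2 : (Q ∪ U ∩ T) ∩ C = Q ∩ C := by
          ext j
          have := hadj j
          grind
        rw [e2] at key
        have : (0 : ℝ) ≤ (Q ∩ T).card := by positivity
        linarith

/-- A component either survives in the unreached part, or its excess is counted by `extra`. -/
lemma HasExcess.extra_or_unreached (hQU : Disjoint Q U) (hS : S ⊆ edgesIn (Q ∪ U))
    (h : HasExcess S (Q ∪ U) k) : k ≤ extra S Q U ∨ HasExcess S (unreached S Q U) k := by
  obtain ⟨C, ⟨hne, hC, hmin⟩, hk⟩ := h
  rcases (Q ∩ C).eq_empty_or_nonempty with h0 | h0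
  · right
    have hCU : C ⊆ U := by
      intro x hx
      have := hC.1 hx
      have h1 : x ∉ Q ∩ C := by simp [h0]
      grind
    have hCR := subset_unreached hCU hC
    refine ⟨C, ⟨hne, ⟨hCR, fun x hx y hy => hC.2 x hx y (isClosedIn_unreached.1 hy)⟩,
      fun D hDC hD => hmin D hDC ⟨hDC.trans hC.1, fun x hx y hy hxy => ?_⟩⟩, hk⟩
    exact hD.2 x hx y (isClosedIn_unreached.2 x (hD.1 hx) y hy hxy) hxy
  · left
    -- By minimality a component meeting the unreached set lies inside it, but that set contains no
    -- root.
    have hdis : Disjoint C (unreached S Q U) := by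
      rw [Finset.disjoint_iff_inter_eq_empty]
      refine (hmin _ Finset.inter_subset_left (hC.inter isClosedIn_unreached)).resolve_right ?_
      intro h
      obtain ⟨x, hx⟩ := h0
      rw [Finset.mem_inter] at hx
      rw [← h] at hx
      exact Finset.disjoint_left.1 hQU hx.1 (unreached_subset (Finset.mem_inter.1 hx.2).2)
    have := edgeCount_add_le_extra rfl hQU hS hC hdis
    have h1 : (1 : ℝ) ≤ (Q ∩ C).card := by exact_mod_cast h0.card_pos
    linarith

/-- Exploring from a vertex of a component exhausts exactly this component. -/
lemma IsComponent.sdiff_unreached (hC : IsComponent S X C) (hv : v ∈ C) :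
    insert v (X.erase v \ unreached S {v} (X.erase v)) = C := by
  obtain ⟨-, hC, hmin⟩ := hC
  have hX : {v} ∪ X.erase v = X := by
    rw [← Finset.insert_eq, Finset.insert_erase (hC.1 hv)]
  have hR := isClosedIn_unreached (S := S) (Q := {v}) (U := X.erase v)
  rw [hX] at hR
  have hvR : v ∉ unreached S {v} (X.erase v) := fun h => by
    simpa using unreached_subset h
  have h1 : C ∩ unreached S {v} (X.erase v) = ∅ := by
    refine (hmin _ Finset.inter_subset_left (hC.inter hR)).resolve_right fun h => hvR ?_
    rw [← h] at hv
    exact (Finset.mem_inter.1 hv).2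
  have h2 : X \ C ⊆ unreached S {v} (X.erase v) := by
    refine subset_unreached (fun x hx => ?_) (by rw [hX]; exact hC.compl)
    rw [Finset.mem_sdiff] at hx
    exact Finset.mem_erase.2 ⟨fun h => hx.2 (h ▸ hv), hx.1⟩
  ext x
  have h3 := Finset.ext_iff.1 h1 x
  have h4 := @h2 x
  have h5 : x ∈ C → x ∈ X := fun h => hC.1 h
  simp only [Finset.mem_inter, Finset.notMem_empty, iff_false, not_and, Finset.mem_sdiff,
    Finset.mem_insert, Finset.mem_erase] at h3 h4 ⊢
  grind

lemma IsComponent.reachedMass_eq (hC : IsComponent S X C) (hv : v ∈ C) :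
    reachedMass w S {v} (X.erase v) = ∑ i ∈ C, w i := by
  conv_rhs => rw [← hC.sdiff_unreached hv]
  rw [Finset.sum_insert (by simp), reachedMass, Finset.sum_singleton]

lemma IsComponent.extra_eq (hC : IsComponent S X C) (hv : v ∈ C) :
    extra S {v} (X.erase v) = edgeCount S C + 1 - C.card := by
  have h := hC.sdiff_unreached hv
  have hvR : v ∉ unreached S {v} (X.erase v) := fun h => by
    simpa using unreached_subset h
  have hcard := congrArg Finset.card h
  rw [Finset.card_insert_of_notMem (by simp)] at hcard
  have h2 : ({v} ∪ X.erase v) \ unreached S {v} (X.erase v) = C := by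
    rw [← Finset.insert_eq, Finset.insert_sdiff_of_notMem _ hvR, h]
  rw [extra, h2, ← hcard]
  push_cast
  ring

end Exploration

/-! ### The random graph and one step of the exploration -/

section Step

variable {V : Type*}

/-- The probability that the edge `e` is present. -/
def edgeProb (w : V → ℝ) (p : ℝ) (e : Sym2 V) : ℝ := 1 - Real.exp (-((e.map w).mul * p))

variable {w : V → ℝ} {p : ℝ}

lemma edgeProb_mk (i j : V) : edgeProb w p s(i, j) = 1 - Real.exp (-(p * w i * w j)) := by
  simp only [edgeProb, Sym2.map_mk, Sym2.mul_mk]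
  ring_nf

lemma edgeProb_nonneg (hw : ∀ i, 0 < w i) (hp : 0 ≤ p) (e : Sym2 V) : 0 ≤ edgeProb w p e := by
  induction e with | h i j =>
  rw [edgeProb_mk, sub_nonneg, Real.exp_le_one_iff, neg_nonpos]
  have := hw i
  have := hw j
  positivity

lemma edgeProb_le_one (e : Sym2 V) : edgeProb w p e ≤ 1 := by
  unfold edgeProb
  linarith [Real.exp_pos (-((e.map w).mul * p))]

variable [DecidableEq V]

/-- The expectation of a functional of the rank-one random graph on the vertex set `X`. -/
def gexp (w : V → ℝ) (p : ℝ) (X : Finset V) (F : Finset (Sym2 V) → ℝ) : ℝ :=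
  bexp (edgeProb w p) (edgesIn X) F

lemma gexp_mono (hw : ∀ i, 0 < w i) (hp : 0 ≤ p) {X : Finset V} {F G : Finset (Sym2 V) → ℝ}
    (h : ∀ S ⊆ edgesIn X, F S ≤ G S) : gexp w p X F ≤ gexp w p X G :=
  bexp_mono (edgeProb_nonneg hw hp) edgeProb_le_one h

lemma gexp_le_one (hw : ∀ i, 0 < w i) (hp : 0 ≤ p) {X : Finset V} {F : Finset (Sym2 V) → ℝ}
    (h : ∀ S ⊆ edgesIn X, F S ≤ 1) : gexp w p X F ≤ 1 :=
  (gexp_mono hw hp h).trans_eq (bexp_const 1)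

lemma gexp_nonneg (hw : ∀ i, 0 < w i) (hp : 0 ≤ p) {X : Finset V} {F : Finset (Sym2 V) → ℝ}
    (h : ∀ S ⊆ edgesIn X, 0 ≤ F S) : 0 ≤ gexp w p X F :=
  (bexp_const (q := edgeProb w p) (A := edgesIn X) 0).symm.trans_le (gexp_mono hw hp h)

lemma gexp_insert {v : V} {Y : Finset V} {F : Finset (Sym2 V) → ℝ} (hv : v ∉ Y) :
    gexp w p (insert v Y) F =
      bexp (fun j => edgeProb w p s(v, j)) Y fun T => gexp w p Y fun S => F (star v T ∪ S) :=
  bexp_edgesIn_insert hv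

/-- A second-order expansion followed by 1 + z ≤ e^z. With u = τx and y = lx², one has (u - y)² ≤
2u² + 2y², and y ≤ 1/8 turns 2y² into y/4, leaving -3y/4. Since q ≥ r/2, at least 3/8 of y survives
per unit of r. Replacing q by r in the linear term costs |u|r². -/
lemma one_add_mul_exp_sub_one_le {r q τ l x : ℝ} (hr0 : 0 ≤ r) (hr1 : r ≤ 1)
    (hq : q = 1 - Real.exp (-r)) (hx : 0 ≤ x) (hτ : |τ| * x ≤ 1 / 2) (hl : 0 ≤ l)
    (hlx : l * x ^ 2 ≤ 1 / 8) :
    1 + q * (Real.exp (τ * x - l * x ^ 2) - 1) ≤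
      Real.exp (r * (τ * x) + (2 * τ ^ 2 * x ^ 2 + |τ| * x * r - 3 / 8 * l * x ^ 2) * r) := by
  have hq1 : q ≤ r := by rw [hq]; linarith [Real.add_one_le_exp (-r)]
  have hq2 : r - r ^ 2 / 2 ≤ q := by
    have h1 := Real.quadratic_le_exp_of_nonneg hr0
    have h2 : Real.exp (-r) * Real.exp r = 1 := by rw [← Real.exp_add]; simp
    have h3 := Real.exp_pos (-r)
    have h4 : Real.exp (-r) * (1 + r + r ^ 2 / 2) ≤ 1 :=
      (mul_le_mul_of_nonneg_left h1 h3.le).trans_eq h2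
    have h5 : Real.exp (-r) ≤ 1 - r + r ^ 2 / 2 := by
      by_contra! h
      have := mul_lt_mul_of_pos_right h (show 0 < 1 + r + r ^ 2 / 2 by positivity)
      nlinarith [pow_nonneg hr0 4]
    linarith
  have hq0 : r / 2 ≤ q := by nlinarith
  have hτx : |τ * x| ≤ 1 / 2 := by rw [abs_mul, abs_of_nonneg hx]; exact hτ
  have hlx0 : 0 ≤ l * x ^ 2 := by positivity
  obtain ⟨ha, hb⟩ := abs_le.1 hτx
  set u := τ * x
  set y := l * x ^ 2
  have h1 : Real.exp (u - y) - 1 ≤ (u - y) + (u - y) ^ 2 := by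
    have := Real.abs_exp_sub_one_sub_id_le (x := u - y) (by rw [abs_le]; constructor <;> linarith)
    linarith [(abs_le.1 this).2]
  have h2 : (u - y) + (u - y) ^ 2 ≤ u + 2 * u ^ 2 - 3 / 4 * y := by
    nlinarith [sq_nonneg (u + y)]
  have h3 : q * (u + 2 * u ^ 2 - 3 / 4 * y) ≤
      r * u + (2 * u ^ 2 + |u| * r - 3 / 8 * y) * r := by
    have e1 : q * u ≤ r * u + |u| * r * r := by
      have : (q - r) * u ≤ |u| * r ^ 2 := by
        calc (q - r) * u ≤ |(q - r) * u| := le_abs_self _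
          _ = |q - r| * |u| := abs_mul _ _
          _ ≤ r ^ 2 * |u| := by
            refine mul_le_mul_of_nonneg_right ?_ (abs_nonneg _)
            rw [abs_le]; constructor <;> nlinarith
          _ = _ := by ring
      nlinarith
    have e2 : q * u ^ 2 ≤ r * u ^ 2 := mul_le_mul_of_nonneg_right hq1 (sq_nonneg _)
    have e3 : r / 2 * y ≤ q * y := mul_le_mul_of_nonneg_right hq0 hlx0
    nlinarith
  have hqn : 0 ≤ q := by linarith
  have e4 : |u| = |τ| * x := by rw [abs_mul, abs_of_nonneg hx]
  calc 1 + q * (Real.exp (u - y) - 1) ≤ 1 + q * (u + 2 * u ^ 2 - 3 / 4 * y) := by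
        linarith [mul_le_mul_of_nonneg_left (h1.trans h2) hqn]
    _ ≤ Real.exp (q * (u + 2 * u ^ 2 - 3 / 4 * y)) := by
        linarith [Real.add_one_le_exp (q * (u + 2 * u ^ 2 - 3 / 4 * y))]
    _ ≤ _ := by
        refine Real.exp_le_exp.2 (h3.trans_eq ?_)
        rw [e4]; simp only [u, y]; ring

/-- The exponential moment of the edges from `v` to already active vertices. -/
lemma bexp_exp_card_le (hw : ∀ i, 0 < w i) (hp : 0 ≤ p) {γ : ℝ} (hγ : 0 ≤ γ) (v : V)
    (Q : Finset V) :
    bexp (fun j => edgeProb w p s(v, j)) Q (fun T => Real.exp (γ * T.card)) ≤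
      Real.exp ((Real.exp γ - 1) * p * w v * ∑ i ∈ Q, w i) := by
  have h1 : ∀ T : Finset V, Real.exp (γ * T.card) = ∏ j ∈ T, Real.exp γ := fun T => by
    rw [Finset.prod_const, ← Real.exp_nat_mul, mul_comm]
  simp only [h1]
  rw [bexp_prod, Finset.mul_sum, Real.exp_sum]
  refine Finset.prod_le_prod (fun j _ => ?_) fun j _ => ?_
  · have := edgeProb_nonneg hw hp s(v, j)
    have := sub_nonneg.2 (Real.one_le_exp hγ)
    positivity
  · have h2 := sub_nonneg.2 (Real.one_le_exp hγ)
    have h3 : edgeProb w p s(v, j) ≤ p * w v * w j := by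
      rw [edgeProb_mk]; linarith [Real.add_one_le_exp (-(p * w v * w j))]
    calc _ ≤ 1 + p * w v * w j * (Real.exp γ - 1) := by gcongr
      _ ≤ Real.exp (p * w v * w j * (Real.exp γ - 1)) := by
        linarith [Real.add_one_le_exp (p * w v * w j * (Real.exp γ - 1))]
      _ = _ := by ring_nf

/-- The exponential moment of the newly discovered vertices. -/
lemma bexp_exp_sum_le (hw : ∀ i, 0 < w i) (hp : 0 ≤ p) {τ l : ℝ} {v : V} {U : Finset V}
    (hpw : ∀ i, p * w v * w i ≤ 1) (hτ : ∀ i, |τ| * w i ≤ 1 / 2) (hl : 0 ≤ l)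
    (hlw : ∀ i, l * w i ^ 2 ≤ 1 / 8) :
    bexp (fun j => edgeProb w p s(v, j)) U
        (fun T => Real.exp (τ * ∑ i ∈ T, w i - l * ∑ i ∈ T, w i ^ 2)) ≤
      Real.exp (w v * (τ * (p * ∑ i ∈ U, w i ^ 2) +
        (2 * τ ^ 2 + |τ| * (p * w v) - 3 / 8 * l) * (p * ∑ i ∈ U, w i ^ 3))) := by
  have h1 : ∀ T : Finset V, Real.exp (τ * ∑ i ∈ T, w i - l * ∑ i ∈ T, w i ^ 2) =
      ∏ j ∈ T, Real.exp (τ * w j - l * w j ^ 2) := fun T => by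
    rw [← Real.exp_sum, Finset.sum_sub_distrib, Finset.mul_sum, Finset.mul_sum]
  have h2 : w v * (τ * (p * ∑ i ∈ U, w i ^ 2) +
        (2 * τ ^ 2 + |τ| * (p * w v) - 3 / 8 * l) * (p * ∑ i ∈ U, w i ^ 3)) =
      ∑ j ∈ U, (p * w v * w j * (τ * w j) + (2 * τ ^ 2 * w j ^ 2 +
        |τ| * w j * (p * w v * w j) - 3 / 8 * l * w j ^ 2) * (p * w v * w j)) := by
    simp only [Finset.mul_sum]
    rw [← Finset.sum_add_distrib, Finset.mul_sum]
    exact Finset.sum_congr rfl fun j _ => by ring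
  simp only [h1]
  rw [bexp_prod, h2, Real.exp_sum]
  refine Finset.prod_le_prod (fun j _ => ?_) fun j _ => ?_
  · have h3 := edgeProb_nonneg hw hp s(v, j)
    have h4 := edgeProb_le_one (w := w) (p := p) s(v, j)
    nlinarith [Real.exp_pos (τ * w j - l * w j ^ 2)]
  · have := hw v
    have := hw j
    exact one_add_mul_exp_sub_one_le (by positivity) (hpw j) (edgeProb_mk v j) (hw j).le (hτ j)
      hl (hlw j)

/-- Independence of the surplus edges (to Q) from the discoveries (to U) within one step. -/
lemma bexp_union_inter {q : V → ℝ} {Q U : Finset V} (hQU : Disjoint Q U)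
    (f g : Finset V → ℝ) :
    bexp q (Q ∪ U) (fun T => f (Q ∩ T) * g (U ∩ T)) = bexp q Q f * bexp q U g := by
  rw [bexp_union hQU]
  calc _ = bexp q Q fun S => bexp q U g * f S := by
        refine bexp_congr fun S hS => ?_
        rw [mul_comm, ← bexp_mul_left]
        refine bexp_congr fun T hT => ?_
        have e1 : Q ∩ (S ∪ T) = S := by
          rw [Finset.disjoint_left] at hQU; grind
        have e2 : U ∩ (S ∪ T) = T := by
          rw [Finset.disjoint_left] at hQU; grind
        rw [e1, e2]
    _ = _ := by rw [bexp_mul_left, mul_comm]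

/-- Bounding the expectation of a functional of the exploration by a function of its state. -/
lemma gexp_le_of_step {α : Type*} (hw : ∀ i, 0 < w i) (hp : 0 ≤ p)
    {F : α → Finset (Sym2 V) → Finset V → Finset V → ℝ} {B : α → Finset V → Finset V → ℝ}
    {U₀ : Finset V}
    (base : ∀ a, ∀ U ⊆ U₀, gexp w p U (fun S => F a S ∅ U) ≤ B a ∅ U)
    (step : ∀ a v Q U, v ∉ Q ∪ U → Disjoint Q U → U ⊆ U₀ →
      gexp w p (insert v Q ∪ U) (fun S => F a S (insert v Q) U) ≤ B a (insert v Q) U ∨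
      ∃ next : Finset V → α,
        (∀ T ⊆ Q ∪ U, ∀ S ⊆ edgesIn (Q ∪ U), F a (star v T ∪ S) (insert v Q) U ≤
          F (next T) S (Q ∪ U ∩ T) (U \ T)) ∧
        bexp (fun j => edgeProb w p s(v, j)) (Q ∪ U)
          (fun T => B (next T) (Q ∪ U ∩ T) (U \ T)) ≤ B a (insert v Q) U) :
    ∀ a Q U, Disjoint Q U → U ⊆ U₀ → gexp w p (Q ∪ U) (fun S => F a S Q U) ≤ B a Q U := by
  suffices ∀ m a Q U, (Q ∪ U).card = m → Disjoint Q U → U ⊆ U₀ →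
      gexp w p (Q ∪ U) (fun S => F a S Q U) ≤ B a Q U from
    fun a Q U => this _ a Q U rfl
  intro m
  induction m with
  | zero =>
    intro a Q U hm _ hU
    rw [Finset.card_eq_zero, Finset.union_eq_empty] at hm
    obtain ⟨rfl, rfl⟩ := hm
    simpa using base a ∅ hU
  | succ m ih =>
    intro a Q U hm hQU hU
    rcases Q.eq_empty_or_nonempty with rfl | ⟨v, hvQ⟩
    · simpa using base a U hU
    · obtain ⟨Q, hvQ1, rfl⟩ : ∃ Q1, v ∉ Q1 ∧ insert v Q1 = Q :=
        ⟨Q.erase v, by simp, Finset.insert_erase hvQ⟩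
      rw [Finset.disjoint_insert_left] at hQU
      have hv : v ∉ Q ∪ U := by simp [hvQ1, hQU.1]
      -- The first alternative plays the role of a stopping time: the bound already holds in this
      -- state. Otherwise `B` is a supermartingale along the step. Any active vertex may be chosen
      -- as v.
      rcases step a v Q U hv hQU.2 hU with h | ⟨next, h1, h2⟩
      · exact h
      · refine le_trans ?_ h2
        rw [Finset.insert_union] at hm ⊢
        rw [Finset.card_insert_of_notMem hv] at hm
        rw [gexp_insert hv]
        refine bexp_mono (fun e => edgeProb_nonneg hw hp _) (fun e => edgeProb_le_one _)
          fun T hT => ?_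
        have := ih (next T) (Q ∪ U ∩ T) (U \ T) (by rw [union_step]; omega)
          (by have := hQU.2; rw [Finset.disjoint_left] at this ⊢; grind)
          (Finset.sdiff_subset.trans hU)
        rw [union_step] at this
        exact (gexp_mono hw hp (h1 T hT)).trans this

lemma sum_union_inter {f : V → ℝ} {Q U T : Finset V} (hQU : Disjoint Q U) :
    ∑ i ∈ Q ∪ U ∩ T, f i = ∑ i ∈ Q, f i + ∑ i ∈ U ∩ T, f i :=
  Finset.sum_union (hQU.mono_right Finset.inter_subset_left)

lemma sum_sdiff_inter {f : V → ℝ} {U T : Finset V} :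
    ∑ i ∈ U \ T, f i = ∑ i ∈ U, f i - ∑ i ∈ U ∩ T, f i := by
  rw [← Finset.sum_inter_add_sum_sdiff U T]; ring

lemma unreached_empty (S : Finset (Sym2 V)) (U : Finset V) : unreached S ∅ U = U :=
  unreached_subset.antisymm (subset_unreached subset_rfl
    ⟨by simp, fun _ _ y hy _ => by simpa using hy⟩)

lemma reachedMass_empty (S : Finset (Sym2 V)) (U : Finset V) : reachedMass w S ∅ U = 0 := by
  simp [reachedMass, unreached_empty]

lemma extra_empty (S : Finset (Sym2 V)) (U : Finset V) : extra S ∅ U = 0 := by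
  simp [extra, unreached_empty, edgeCount, edgesIn]

lemma sum_le_reachedMass (hw : ∀ i, 0 < w i) (S : Finset (Sym2 V)) (Q U : Finset V) :
    ∑ i ∈ Q, w i ≤ reachedMass w S Q U :=
  le_add_of_nonneg_right (Finset.sum_nonneg fun i _ => (hw i).le)

end Step

/-! ### Subcritical exploration -/

open Classical in
/-- The indicator of a proposition. -/
def ind (P : Prop) : ℝ := if P then 1 else 0

lemma ind_of_true {P : Prop} (h : P) : ind P = 1 := if_pos h

lemma ind_of_false {P : Prop} (h : ¬ P) : ind P = 0 := if_neg h

lemma ind_nonneg (P : Prop) : 0 ≤ ind P := by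
  by_cases h : P <;> simp [ind, h]

lemma ind_le_of {P : Prop} {x : ℝ} (h0 : 0 ≤ x) (h : P → 1 ≤ x) : ind P ≤ x := by
  by_cases hP : P
  · rw [ind_of_true hP]; exact h hP
  · rw [ind_of_false hP]; exact h0

lemma ind_le_one (P : Prop) : ind P ≤ 1 := ind_le_of zero_le_one fun _ => le_rfl

lemma ind_mono {P Q : Prop} (h : P → Q) : ind P ≤ ind Q :=
  ind_le_of (ind_nonneg Q) fun hP => (ind_of_true (h hP)).ge

section Subcritical

variable {V : Type*} [DecidableEq V] {w : V → ℝ} {p θ t : ℝ} {U₀ : Finset V}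

/-- The supermartingale is exp(t · explored weight + θ · active weight): processing v adds t w_v and
removes θ w_v, which `hstep` compensates. The parameter `m` records the explored weight. -/
lemma gexp_exp_reachedMass_le (hw : ∀ i, 0 < w i) (hp : 0 ≤ p)
    (hstep : ∀ v, ∀ U ⊆ U₀, bexp (fun j => edgeProb w p s(v, j)) U
      (fun T => Real.exp (θ * ∑ i ∈ T, w i)) ≤ Real.exp ((θ - t) * w v))
    {Q U : Finset V} (hQU : Disjoint Q U) (hU : U ⊆ U₀) :
    gexp w p (Q ∪ U) (fun S => Real.exp (t * reachedMass w S Q U)) ≤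
      Real.exp (θ * ∑ i ∈ Q, w i) := by
  have key := gexp_le_of_step (U₀ := U₀) hw hp
    (F := fun (m : ℝ) S Q U => Real.exp (t * (m + reachedMass w S Q U)))
    (B := fun m Q _ => Real.exp (t * m + θ * ∑ i ∈ Q, w i)) ?_ ?_ 0 Q U hQU hU
  · simpa using key
  · intro m U _
    simp only [reachedMass_empty, Finset.sum_empty, mul_zero, add_zero]
    exact (bexp_const _).le
  · intro m v Q U hv hQU hU
    refine Or.inr ⟨fun _ => m + w v, fun T hT S hS => ?_, ?_⟩
    · rw [reachedMass_star hv hQU hS]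
      exact le_of_eq (by ring_nf)
    · have hvQ : v ∉ Q := fun h => hv (Finset.mem_union_left _ h)
      calc _ = Real.exp (t * (m + w v) + θ * ∑ i ∈ Q, w i) *
            bexp (fun j => edgeProb w p s(v, j)) (Q ∪ U)
              (fun T => 1 * Real.exp (θ * ∑ i ∈ U ∩ T, w i)) := by
            rw [← bexp_mul_left]
            refine bexp_congr fun T _ => ?_
            rw [sum_union_inter hQU, one_mul, ← Real.exp_add]
            ring_nf
        _ ≤ Real.exp (t * (m + w v) + θ * ∑ i ∈ Q, w i) * Real.exp ((θ - t) * w v) := by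
            rw [bexp_union_inter hQU (fun _ => 1) (fun T => Real.exp (θ * ∑ i ∈ T, w i)),
              bexp_const, one_mul]
            exact mul_le_mul_of_nonneg_left (hstep v U hU) (Real.exp_pos _).le
        _ = _ := by
            rw [Finset.sum_insert hvQ, ← Real.exp_add]
            ring_nf

/-- Markov's inequality for exp(tM) - 1 rather than exp(tM): the numerator is then linear in a small
starting weight. This extra factor is what turns later sums over starting vertices into second
moments. -/
lemma gexp_reachedMass_tail (hw : ∀ i, 0 < w i) (hp : 0 ≤ p) (ht : 0 < t)
    (hstep : ∀ v, ∀ U ⊆ U₀, bexp (fun j => edgeProb w p s(v, j)) U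
      (fun T => Real.exp (θ * ∑ i ∈ T, w i)) ≤ Real.exp ((θ - t) * w v))
    {Q U : Finset V} (hQU : Disjoint Q U) (hU : U ⊆ U₀) {y : ℝ} (hy : 0 < y) :
    gexp w p (Q ∪ U) (fun S => ind (y ≤ reachedMass w S Q U)) ≤
      (Real.exp (θ * ∑ i ∈ Q, w i) - 1) / (Real.exp (t * y) - 1) := by
  have hpos : 0 < Real.exp (t * y) - 1 := sub_pos.2 (Real.one_lt_exp_iff.2 (mul_pos ht hy))
  calc _ ≤ gexp w p (Q ∪ U) (fun S => (Real.exp (t * y) - 1)⁻¹ *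
          (Real.exp (t * reachedMass w S Q U) + -1)) := by
        refine gexp_mono hw hp fun S _ => ind_le_of ?_ fun h => ?_
        · have : 0 ≤ reachedMass w S Q U :=
            (Finset.sum_nonneg fun i _ => (hw i).le).trans (sum_le_reachedMass hw S Q U)
          have := Real.one_le_exp (mul_nonneg ht.le this)
          exact mul_nonneg (inv_nonneg.2 hpos.le) (by linarith)
        · rw [← div_eq_inv_mul, le_div_iff₀ hpos, one_mul]
          have := Real.exp_le_exp.2 (mul_le_mul_of_nonneg_left h ht.le)
          linarith
    _ = (Real.exp (t * y) - 1)⁻¹ *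
          (gexp w p (Q ∪ U) (fun S => Real.exp (t * reachedMass w S Q U)) + -1) := by
        unfold gexp
        rw [bexp_mul_left, bexp_add, bexp_const]
    _ ≤ _ := by
        rw [div_eq_inv_mul]
        have := gexp_exp_reachedMass_le hw hp hstep hQU hU
        exact mul_le_mul_of_nonneg_left (by linarith) (inv_nonneg.2 hpos.le)

/-- In a subcritical exploration, a large number of extra edges is unlikely: either the active
weight exceeds `H` at some time, or the extra edges are few. -/
lemma gexp_extra_le_of_subcritical (hw : ∀ i, 0 < w i) (hp : 0 ≤ p) (hθ : 0 < θ) (ht : 0 ≤ t)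
    (hstep : ∀ v, ∀ U ⊆ U₀, bexp (fun j => edgeProb w p s(v, j)) U
      (fun T => Real.exp (θ * ∑ i ∈ T, w i)) ≤ Real.exp ((θ - t) * w v))
    {γ H c : ℝ} (hγ : 0 ≤ γ) (hH : 0 < H) (hc : (Real.exp γ - 1) * p * H ≤ c)
    {Q U : Finset V} (hQU : Disjoint Q U) (hU : U ⊆ U₀) (k y z : ℝ) :
    gexp w p (Q ∪ U) (fun S => ind (k ≤ extra S Q U ∧ y ≤ reachedMass w S Q U ∧
        reachedMass w S Q U ≤ z)) ≤
      Real.exp (c * z - γ * k) * gexp w p (Q ∪ U) (fun S => ind (y ≤ reachedMass w S Q U)) +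
        (Real.exp (θ * ∑ i ∈ Q, w i) - 1) / (Real.exp (θ * H) - 1) := by
  have hγ1 : 0 ≤ Real.exp γ - 1 := sub_nonneg.2 (Real.one_le_exp hγ)
  have hc0 : 0 ≤ c := le_trans (by positivity) hc
  have hpos : 0 < Real.exp (θ * H) - 1 := sub_pos.2 (Real.one_lt_exp_iff.2 (mul_pos hθ hH))
  have hterm : ∀ Q : Finset V,
      0 ≤ (Real.exp (θ * ∑ i ∈ Q, w i) - 1) / (Real.exp (θ * H) - 1) := fun Q =>
    div_nonneg (sub_nonneg.2 (Real.one_le_exp (mul_nonneg hθ.le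
      (Finset.sum_nonneg fun i _ => (hw i).le)))) hpos.le
  have key := gexp_le_of_step (U₀ := U₀) hw hp
    (F := fun (a : ℝ × ℝ × ℝ) S Q U => ind (a.1 ≤ extra S Q U ∧ a.2.1 ≤ reachedMass w S Q U ∧
        reachedMass w S Q U ≤ a.2.2))
    (B := fun a Q U => Real.exp (c * a.2.2 - γ * a.1) *
      gexp w p (Q ∪ U) (fun S => ind (a.2.1 ≤ reachedMass w S Q U)) +
        (Real.exp (θ * ∑ i ∈ Q, w i) - 1) / (Real.exp (θ * H) - 1)) ?_ ?_ (k, y, z) Q U hQU hU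
  · exact key
  · rintro ⟨k, y, z⟩ U _
    simp only [extra_empty, reachedMass_empty, Finset.sum_empty, mul_zero, Real.exp_zero, sub_self,
      zero_div, add_zero]
    simp only [gexp, bexp_const]
    refine ind_le_of (mul_nonneg (Real.exp_pos _).le (ind_nonneg _)) ?_
    rintro ⟨h1, h2, h3⟩
    rw [ind_of_true h2, mul_one]
    refine Real.one_le_exp ?_
    have := mul_nonneg hc0 h3
    have := mul_nonneg hγ (neg_nonneg.2 h1)
    linarith
  · rintro ⟨k, y, z⟩ v Q U hv hQU hU
    have hvQ : v ∉ Q := fun h => hv (Finset.mem_union_left _ h)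
    have hg0 : ∀ Q U : Finset V, ∀ y,
        0 ≤ gexp w p (Q ∪ U) (fun S => ind (y ≤ reachedMass w S Q U)) :=
      fun Q U y => gexp_nonneg hw hp fun S _ => ind_nonneg _
    -- Once the active weight exceeds H, the last term of the bound is at least 1.
    by_cases ha : H < ∑ i ∈ insert v Q, w i
    · left
      refine (gexp_le_one hw hp fun S _ => ind_le_one _).trans ?_
      have h1 : 1 ≤ (Real.exp (θ * ∑ i ∈ insert v Q, w i) - 1) / (Real.exp (θ * H) - 1) := by
        rw [le_div_iff₀ hpos, one_mul]
        have := Real.exp_le_exp.2 (mul_le_mul_of_nonneg_left ha.le hθ.le)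
        linarith
      have := mul_nonneg (Real.exp_pos (c * z - γ * k)).le (hg0 (insert v Q) U y)
      dsimp only
      linarith
    by_cases hz : z < w v
    · left
      refine le_trans (gexp_mono hw hp (G := fun _ => 0) fun S _ => ?_) ?_
      · rw [ind_of_false]
        rintro ⟨-, -, h3⟩
        have h4 := sum_le_reachedMass hw S (insert v Q) U
        rw [Finset.sum_insert hvQ] at h4
        have : 0 ≤ ∑ i ∈ Q, w i := Finset.sum_nonneg fun i _ => (hw i).le
        dsimp only at h3
        linarith
      · rw [gexp, bexp_const]
        exact add_nonneg (mul_nonneg (Real.exp_pos _).le (hg0 _ _ _)) (hterm _)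
    rw [not_lt] at ha hz
    refine Or.inr ⟨fun T => (k - (Q ∩ T).card, y - w v, z - w v), fun T hT S hS => ?_, ?_⟩
    · rw [extra_star hv hQU hS, reachedMass_star hv hQU hS]
      refine ind_mono ?_
      rintro ⟨h1, h2, h3⟩
      dsimp only at h1 h2 h3 ⊢
      exact ⟨by linarith, by linarith, by linarith⟩
    · dsimp only
      -- The tail probability of the weight is an exact martingale that depends on T only through `U
      -- ∩ T`, hence it decouples from the surplus edges.
      have e1 : gexp w p (insert v Q ∪ U) (fun S => ind (y ≤ reachedMass w S (insert v Q) U)) =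
          bexp (fun j => edgeProb w p s(v, j)) U (fun T => gexp w p (Q ∪ U)
            (fun S => ind (y - w v ≤ reachedMass w S (Q ∪ U ∩ T) (U \ T)))) := by
        rw [Finset.insert_union, gexp_insert hv]
        have : ∀ T ⊆ Q ∪ U, (gexp w p (Q ∪ U) fun S =>
            ind (y ≤ reachedMass w (star v T ∪ S) (insert v Q) U)) = 1 *
            gexp w p (Q ∪ U) fun S => ind (y - w v ≤
              reachedMass w S (Q ∪ U ∩ (U ∩ T)) (U \ (U ∩ T))) := by
          intro T _
          rw [one_mul, Finset.inter_eq_right.2 Finset.inter_subset_left,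
            Finset.sdiff_inter_self_left]
          refine bexp_congr fun S hS => ?_
          rw [reachedMass_star hv hQU hS, sub_le_iff_le_add']
        rw [bexp_congr this, bexp_union_inter hQU (fun _ => 1) (fun T => gexp w p (Q ∪ U)
            (fun S => ind (y - w v ≤ reachedMass w S (Q ∪ U ∩ T) (U \ T)))), bexp_const, one_mul]
      have hsplit : bexp (fun j => edgeProb w p s(v, j)) (Q ∪ U) (fun T =>
          Real.exp (c * (z - w v) - γ * (k - (Q ∩ T).card)) *
          gexp w p (Q ∪ U ∩ T ∪ U \ T)
            (fun S => ind (y - w v ≤ reachedMass w S (Q ∪ U ∩ T) (U \ T)))) =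
          Real.exp (c * (z - w v) - γ * k) *
            (bexp (fun j => edgeProb w p s(v, j)) Q (fun T => Real.exp (γ * T.card)) *
            gexp w p (insert v Q ∪ U) (fun S => ind (y ≤ reachedMass w S (insert v Q) U))) := by
        rw [e1, ← bexp_union_inter hQU, ← bexp_mul_left]
        refine bexp_congr fun T _ => ?_
        rw [union_step, ← mul_assoc, ← Real.exp_add, Finset.inter_eq_right.2
          Finset.inter_subset_left, Finset.sdiff_inter_self_left]
        ring_nf
      have hfirst := bexp_exp_card_le hw hp hγ v Q
      have hQle : ∑ i ∈ Q, w i ≤ H := by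
        rw [Finset.sum_insert hvQ] at ha
        linarith [hw v]
      have hfirst2 : bexp (fun j => edgeProb w p s(v, j)) Q (fun T => Real.exp (γ * T.card)) ≤
          Real.exp (c * w v) := by
        refine hfirst.trans (Real.exp_le_exp.2 ?_)
        calc (Real.exp γ - 1) * p * w v * ∑ i ∈ Q, w i
            ≤ (Real.exp γ - 1) * p * w v * H := by
              have := hw v
              gcongr
          _ = (Real.exp γ - 1) * p * H * w v := by ring
          _ ≤ _ := mul_le_mul_of_nonneg_right hc (hw v).le
      have hsecond : bexp (fun j => edgeProb w p s(v, j)) (Q ∪ U) (fun T =>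
          (Real.exp (θ * ∑ i ∈ Q ∪ U ∩ T, w i) - 1) / (Real.exp (θ * H) - 1)) ≤
          (Real.exp (θ * ∑ i ∈ insert v Q, w i) - 1) / (Real.exp (θ * H) - 1) := by
        have e2 : ∀ T ⊆ Q ∪ U, (Real.exp (θ * ∑ i ∈ Q ∪ U ∩ T, w i) - 1) /
            (Real.exp (θ * H) - 1) = (Real.exp (θ * H) - 1)⁻¹ * (Real.exp (θ * ∑ i ∈ Q, w i) *
              (1 * Real.exp (θ * ∑ i ∈ U ∩ T, w i)) + -1) := by
          intro T _
          rw [sum_union_inter hQU, mul_add, Real.exp_add]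
          ring
        rw [bexp_congr e2, bexp_mul_left, bexp_add, bexp_mul_left, bexp_const,
          bexp_union_inter hQU (fun _ => 1) (fun T => Real.exp (θ * ∑ i ∈ T, w i)), bexp_const,
          one_mul, div_eq_inv_mul, Finset.sum_insert hvQ, mul_add θ, Real.exp_add]
        refine mul_le_mul_of_nonneg_left ?_ (inv_nonneg.2 hpos.le)
        have h1 := hstep v U hU
        have h2 : Real.exp ((θ - t) * w v) ≤ Real.exp (θ * w v) := by
          refine Real.exp_le_exp.2 ?_
          have := mul_nonneg ht (hw v).le
          linarith
        have := mul_le_mul_of_nonneg_left (h1.trans h2) (Real.exp_pos (θ * ∑ i ∈ Q, w i)).le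
        linarith
      rw [bexp_add, hsplit]
      refine add_le_add ?_ hsecond
      rw [← mul_assoc]
      refine mul_le_mul_of_nonneg_right ?_ (hg0 _ _ _)
      calc _ ≤ Real.exp (c * (z - w v) - γ * k) * Real.exp (c * w v) :=
            mul_le_mul_of_nonneg_left hfirst2 (Real.exp_pos _).le
        _ = _ := by rw [← Real.exp_add]; ring_nf

end Subcritical

/-! ### Components of the subcritical graph -/

section Components

lemma singleton_union_erase {W : Type*} [DecidableEq W] {U : Finset W} {v : W} (hv : v ∈ U) : {v} ∪ U.erase v = U := by
  rw [← Finset.insert_eq, Finset.insert_erase hv]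

variable {V : Type*} [Fintype V]

/-- Weights in the critical window at distance `f`: `ε⁻³` is the total weight, `κ` bounds the third
moment from above and `c₀` a truncated third moment from below. -/
structure CriticalWindow (w : V → ℝ) (p ε f κ c₀ : ℝ) : Prop where
  weight_pos : ∀ i, 0 < w i
  eps_pos : 0 < ε
  eps_le : ε ≤ 1 / 10
  one_le : 1 ≤ f
  kappa_pos : 0 < κ
  kappa_le : 8 * κ ≤ f
  c₀_pos : 0 < c₀
  mul_eps_le : f * ε ≤ 1
  mul_eps_le' : 10 * (f * ε) ≤ c₀
  p_eq : p = ε ^ 3 * (1 + f * ε)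
  sum_eq : ε ^ 3 * ∑ i, w i = 1
  sum_sq_le : ε ^ 3 * ∑ i, w i ^ 2 ≤ 1 + ε
  sum_cube_le : ε ^ 3 * ∑ i, w i ^ 3 ≤ κ
  le_sum_min : c₀ ≤ ε ^ 3 * ∑ i, min (w i) 1 ^ 3
  max_le : ∀ i, ε * w i ≤ 1 / 10
  max_sq_le : ∀ i, 640 * (ε * w i) ^ 2 ≤ c₀

variable {w : V → ℝ} {p ε f κ c₀ : ℝ}

namespace CriticalWindow

lemma p_pos (h : CriticalWindow w p ε f κ c₀) : 0 < p := by
  have := h.eps_pos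
  have := h.one_le
  rw [h.p_eq]; positivity

lemma p_le (h : CriticalWindow w p ε f κ c₀) : p ≤ 2 * ε ^ 3 := by
  have := h.eps_pos
  have := h.mul_eps_le
  rw [h.p_eq]
  nlinarith [pow_pos h.eps_pos 3]

lemma le_p (h : CriticalWindow w p ε f κ c₀) : ε ^ 3 ≤ p := by
  have := h.one_le
  have := h.eps_pos
  rw [h.p_eq]
  have : 0 ≤ ε ^ 3 * (f * ε) := by positivity
  linarith

lemma p_mul_mul_le (h : CriticalWindow w p ε f κ c₀) (i j : V) : p * w i * w j ≤ 1 := by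
  have h1 := h.max_le i
  have h2 := h.max_le j
  have h3 := h.weight_pos i
  have h4 := h.weight_pos j
  have h5 := h.eps_pos
  calc p * w i * w j ≤ 2 * ε ^ 3 * w i * w j := by gcongr; exact h.p_le
    _ = 2 * ε * (ε * w i) * (ε * w j) := by ring
    _ ≤ 2 * (1 / 10) * (1 / 10) * (1 / 10) := by
      gcongr
      exact h.eps_le
    _ ≤ 1 := by norm_num

lemma p_mul_le (h : CriticalWindow w p ε f κ c₀) (i : V) : p * w i ≤ ε ^ 2 := by
  have h1 := h.max_le i
  have h3 := h.weight_pos i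
  have h5 := h.eps_pos
  calc p * w i ≤ 2 * ε ^ 3 * w i := by gcongr; exact h.p_le
    _ = 2 * ε ^ 2 * (ε * w i) := by ring
    _ ≤ 2 * ε ^ 2 * (1 / 10) := by gcongr
    _ ≤ _ := by nlinarith [sq_nonneg ε]

lemma p_mul_sum_cube_le (h : CriticalWindow w p ε f κ c₀) (U : Finset V) :
    p * ∑ i ∈ U, w i ^ 3 ≤ 2 * κ := by
  have h0 : ∑ i ∈ U, w i ^ 3 ≤ ∑ i, w i ^ 3 := Finset.sum_le_sum_of_subset_of_nonneg
    (Finset.subset_univ _) fun i _ _ => pow_nonneg (h.weight_pos i).le 3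
  have h1 : 0 ≤ ∑ i ∈ U, w i ^ 3 := Finset.sum_nonneg fun i _ => pow_nonneg (h.weight_pos i).le 3
  calc p * ∑ i ∈ U, w i ^ 3 ≤ 2 * ε ^ 3 * ∑ i, w i ^ 3 :=
        mul_le_mul h.p_le h0 h1 (by have := h.eps_pos; positivity)
    _ = 2 * (ε ^ 3 * ∑ i, w i ^ 3) := by ring
    _ ≤ _ := by linarith [h.sum_cube_le]

lemma p_mul_sum_cube_nonneg (h : CriticalWindow w p ε f κ c₀) (U : Finset V) :
    0 ≤ p * ∑ i ∈ U, w i ^ 3 :=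
  mul_nonneg h.p_pos.le (Finset.sum_nonneg fun i _ => pow_nonneg (h.weight_pos i).le 3)

lemma exp_sub_one_le (h : CriticalWindow w p ε f κ c₀) (v : V) :
    Real.exp (2 * ε * w v) - 1 ≤ 4 * (ε * w v) := by
  have h1 := h.max_le v
  have h2 := mul_pos h.eps_pos (h.weight_pos v)
  have := Real.abs_exp_sub_one_sub_id_le (x := 2 * ε * w v)
    (by rw [abs_le]; constructor <;> linarith)
  nlinarith [(abs_le.1 this).2]

variable [DecidableEq V] {U : Finset V}

/-- The first-order term is at most 2ε - 6fε², the second-order one at most 24κε² ≤ 3fε² because 8κ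
≤ f. -/
lemma subcritical_step (h : CriticalWindow w p ε f κ c₀)
    (hU : p * ∑ i ∈ U, w i ^ 2 ≤ 1 - 3 * (f * ε)) (v : V) {U' : Finset V} (hU' : U' ⊆ U) :
    bexp (fun j => edgeProb w p s(v, j)) U' (fun T => Real.exp (2 * ε * ∑ i ∈ T, w i)) ≤
      Real.exp ((2 * ε - 2 * f * ε ^ 2) * w v) := by
  have hε := h.eps_pos
  have key := bexp_exp_sum_le (τ := 2 * ε) (l := 0) (v := v) (U := U') h.weight_pos h.p_pos.le
    (h.p_mul_mul_le v) (fun i => by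
      rw [abs_of_pos (by positivity)]; linarith [h.max_le i]) le_rfl (by simp)
  simp only [zero_mul, sub_zero, mul_zero] at key
  refine key.trans (Real.exp_le_exp.2 ?_)
  rw [mul_comm (w v), abs_of_pos (by positivity : 0 < 2 * ε)]
  refine mul_le_mul_of_nonneg_right ?_ (h.weight_pos v).le
  have h1 : p * ∑ i ∈ U', w i ^ 2 ≤ 1 - 3 * (f * ε) := le_trans (mul_le_mul_of_nonneg_left
    (Finset.sum_le_sum_of_subset_of_nonneg hU' fun i _ _ => sq_nonneg _) h.p_pos.le) hU
  have h2 := h.p_mul_sum_cube_le U'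
  have h3 := h.p_mul_le v
  have h4 : 2 * (2 * ε) ^ 2 + 2 * ε * (p * w v) ≤ 12 * ε ^ 2 := by
    have := h.eps_le
    nlinarith [mul_le_mul_of_nonneg_left h3 hε.le, sq_nonneg ε]
  have h5 := h.kappa_le
  have h6 : (2 * (2 * ε) ^ 2 + 2 * ε * (p * w v)) * (p * ∑ i ∈ U', w i ^ 3) ≤
      12 * ε ^ 2 * (2 * κ) :=
    mul_le_mul h4 h2 (h.p_mul_sum_cube_nonneg U') (by positivity)
  have h7 := mul_le_mul_of_nonneg_left h1 (by positivity : 0 ≤ 2 * ε)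
  have h8 := mul_le_mul_of_nonneg_left h5 (sq_nonneg ε)
  have h9 : 0 ≤ f * ε ^ 2 := mul_nonneg (by linarith [h.one_le]) (sq_nonneg ε)
  linarith

lemma mass_tail (h : CriticalWindow w p ε f κ c₀)
    (hU : p * ∑ i ∈ U, w i ^ 2 ≤ 1 - 3 * (f * ε)) {v : V} (hv : v ∈ U) {y : ℝ} (hy : 0 < y) :
    gexp w p U (fun S => ind (y ≤ reachedMass w S {v} (U.erase v))) ≤
      4 * (ε * w v) / (Real.exp (2 * f * ε ^ 2 * y) - 1) := by
  have hε := h.eps_pos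
  have hf := h.one_le
  have := gexp_reachedMass_tail (t := 2 * f * ε ^ 2) h.weight_pos h.p_pos.le (by positivity)
    (fun v U' hU' => h.subcritical_step hU v hU') (Q := {v}) (U := U.erase v) (by simp)
    (Finset.erase_subset _ _) hy
  rw [singleton_union_erase hv, Finset.sum_singleton] at this
  refine this.trans (div_le_div_of_nonneg_right (h.exp_sub_one_le v) ?_)
  exact sub_nonneg.2 (Real.one_le_exp (by positivity))

lemma two_mul_exp_neg {x : ℝ} (hx : 1 ≤ x) : (Real.exp (2 * x) - 1)⁻¹ ≤ 2 * Real.exp (-(2 * x)) := by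
  have h1 : 2 ≤ Real.exp (2 * x) := by linarith [Real.add_one_le_exp (2 * x)]
  rw [inv_le_iff_one_le_mul₀ (by linarith)]
  have h2 : Real.exp (-(2 * x)) * Real.exp (2 * x) = 1 := by rw [← Real.exp_add]; simp
  nlinarith [Real.exp_pos (-(2 * x))]

lemma exp_neg_nat_le {c : ℝ} {m : ℕ} (hc : (m : ℝ) ≤ c) (i : ℕ) :
    Real.exp (-(c * i)) ≤ ((1 / 2 : ℝ) ^ i) ^ m := by
  have h1 : Real.exp (-1) ≤ 1 / 2 := by
    rw [Real.exp_neg, inv_eq_one_div]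
    exact one_div_le_one_div_of_le (by norm_num) (by linarith [Real.add_one_le_exp 1])
  calc Real.exp (-(c * i)) ≤ Real.exp (-(m * i : ℝ)) := by
        refine Real.exp_le_exp.2 (neg_le_neg ?_)
        gcongr
    _ = Real.exp (-1) ^ (i * m) := by rw [← Real.exp_nat_mul]; push_cast; ring_nf
    _ ≤ (1 / 2) ^ (i * m) := by gcongr
    _ = _ := pow_mul _ _ _

/-- With r = 2^(-i), reaching weight r/ε² has probability of order ε w_v / r, and many surplus edges
on top of it cost e^(-f) r³. The resulting r² beats the weight 2/r used in `ind_hasExcess_le` and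
leaves a summable r. -/
lemma excess_dyadic (h : CriticalWindow w p ε f κ c₀)
    (hU : p * ∑ i ∈ U, w i ^ 2 ≤ 1 - 3 * (f * ε)) {v : V} (hv : v ∈ U) {k : ℝ}
    (hk : 20 * f ≤ k) (i : ℕ) :
    gexp w p U (fun S => ind (k ≤ extra S {v} (U.erase v) ∧
        (1 / 2) ^ i / 2 / ε ^ 2 ≤ reachedMass w S {v} (U.erase v) ∧
        reachedMass w S {v} (U.erase v) ≤ (1 / 2) ^ i / ε ^ 2)) ≤
      12 * ((1 / 2) ^ i) ^ 2 * (ε * w v) * Real.exp (-f) := by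
  have hε := h.eps_pos
  have hf := h.one_le
  have hwv := mul_pos hε (h.weight_pos v)
  set r : ℝ := (1 / 2) ^ i with hr
  have hr0 : 0 < r := by positivity
  -- The tilt may grow with i as long as e^γ r stays bounded: e^(1/2) ≤ 2 keeps it below 3. The
  -- exponent is then at most 6(f + i) - (20f + 10i) ≤ -f - 4i.
  set γ : ℝ := 1 + i / 2 with hγ
  -- This makes the overflow probability of order ε w_v e^(-2(f + i)), again summable over scales.
  set H : ℝ := (f + i) / ε with hH
  have hH0 : 0 < H := by positivity
  have hγ0 : 0 ≤ γ := by positivity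
  have key := gexp_extra_le_of_subcritical (θ := 2 * ε) (t := 2 * f * ε ^ 2)
    (c := Real.exp γ * (2 * ε ^ 3) * H) (γ := γ) h.weight_pos h.p_pos.le
    (by positivity) (by positivity)
    (fun v U' hU' => h.subcritical_step hU v hU') (Q := {v}) (U := U.erase v) hγ0 hH0
    (by
      have := h.p_le
      have := h.p_pos
      gcongr
      linarith)
    (by simp) (Finset.erase_subset _ _) k (r / 2 / ε ^ 2) (r / ε ^ 2)
  rw [singleton_union_erase hv, Finset.sum_singleton] at key
  have hexp : Real.exp γ * (2 * ε ^ 3) * H * (r / ε ^ 2) ≤ 6 * (f + i) := by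
    have e1 : Real.exp γ * (2 * ε ^ 3) * H * (r / ε ^ 2) = 2 * (Real.exp γ * r) * (f + i) := by
      rw [hH]; field_simp
    have e2 : Real.exp γ * r ≤ 3 := by
      have e3 : Real.exp (1 / 2) ≤ 2 := by
        have := Real.abs_exp_sub_one_sub_id_le (x := 1 / 2) (by rw [abs_le]; norm_num)
        linarith [(abs_le.1 this).2]
      calc Real.exp γ * r = Real.exp 1 * (Real.exp (1 / 2) ^ i * r) := by
            rw [hγ, Real.exp_add, ← Real.exp_nat_mul]; ring_nf
        _ = Real.exp 1 * (Real.exp (1 / 2) * (1 / 2)) ^ i := by rw [hr, mul_pow]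
        _ ≤ 3 * 1 := by
          gcongr
          · exact Real.exp_one_lt_three.le
          · exact pow_le_one₀ (by positivity) (by linarith)
        _ = 3 := by norm_num
    rw [e1]
    have : (0 : ℝ) ≤ f + i := by positivity
    nlinarith
  have hA : Real.exp (Real.exp γ * (2 * ε ^ 3) * H * (r / ε ^ 2) - γ * k) ≤
      Real.exp (-f) * r ^ 3 := by
    have e1 : Real.exp γ * (2 * ε ^ 3) * H * (r / ε ^ 2) - γ * k ≤ -f + -(4 * (i : ℝ)) := by
      have : (i : ℝ) * 20 ≤ i * k := by
        have : (20 : ℝ) ≤ k := by linarith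
        gcongr
      rw [hγ] at hexp ⊢
      linarith
    refine (Real.exp_le_exp.2 e1).trans ?_
    rw [Real.exp_add]
    exact mul_le_mul_of_nonneg_left (exp_neg_nat_le (by norm_num) i) (Real.exp_pos _).le
  have hB : gexp w p U (fun S => ind (r / 2 / ε ^ 2 ≤ reachedMass w S {v} (U.erase v))) ≤
      4 * (ε * w v) / r := by
    refine (h.mass_tail hU hv (by positivity)).trans ?_
    refine div_le_div_of_nonneg_left (by positivity) hr0 ?_
    have e1 : 2 * f * ε ^ 2 * (r / 2 / ε ^ 2) = f * r := by field_simp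
    rw [e1]
    nlinarith [Real.add_one_le_exp (f * r)]
  have hC : (Real.exp (2 * ε * w v) - 1) / (Real.exp (2 * ε * H) - 1) ≤
      4 * (ε * w v) * (2 * (Real.exp (-f) * r ^ 2)) := by
    have e1 : 2 * ε * H = 2 * (f + i) := by rw [hH]; field_simp
    have e2 : (1 : ℝ) ≤ f + i := by
      have : (0 : ℝ) ≤ i := by positivity
      linarith
    rw [e1, div_eq_mul_inv]
    have e3 := two_mul_exp_neg e2
    have e4 : Real.exp (-(2 * (f + i))) ≤ Real.exp (-f) * r ^ 2 := by
      have : -(2 * (f + (i : ℝ))) ≤ -f + -(2 * (i : ℝ)) := by linarith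
      refine (Real.exp_le_exp.2 this).trans ?_
      rw [Real.exp_add]
      exact mul_le_mul_of_nonneg_left (exp_neg_nat_le (by norm_num) i) (Real.exp_pos _).le
    have e5 : 0 ≤ (Real.exp (2 * (f + i)) - 1)⁻¹ :=
      inv_nonneg.2 (sub_nonneg.2 (Real.one_le_exp (by linarith)))
    refine mul_le_mul (h.exp_sub_one_le v) (by linarith) e5 (by positivity)
  have hg0 : 0 ≤ gexp w p U (fun S => ind (r / 2 / ε ^ 2 ≤ reachedMass w S {v} (U.erase v))) :=
    gexp_nonneg h.weight_pos h.p_pos.le fun S _ => ind_nonneg _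
  calc _ ≤ Real.exp (-f) * r ^ 3 * (4 * (ε * w v) / r) +
        4 * (ε * w v) * (2 * (Real.exp (-f) * r ^ 2)) :=
      key.trans (add_le_add (mul_le_mul hA hB hg0 (by positivity)) hC)
    _ = _ := by field_simp; ring

/-- A component of large excess is seen from each of its vertices. -/
lemma ind_hasExcess_le (h : CriticalWindow w p ε f κ c₀) {k : ℝ} {S : Finset (Sym2 V)} {I : ℕ}
    (hI : ∀ v ∈ U, (1 / 2 : ℝ) ^ I < ε ^ 2 * w v) :
    ind (HasExcess S U k) ≤
      ∑ v ∈ U, ε ^ 2 * w v * ind (1 / ε ^ 2 ≤ reachedMass w S {v} (U.erase v)) +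
      ∑ i ∈ Finset.range I, ∑ v ∈ U, ε ^ 2 * w v * (2 / (1 / 2) ^ i) *
        ind (k ≤ extra S {v} (U.erase v) ∧
          (1 / 2) ^ i / 2 / ε ^ 2 ≤ reachedMass w S {v} (U.erase v) ∧
          reachedMass w S {v} (U.erase v) ≤ (1 / 2) ^ i / ε ^ 2) := by
  have hε := h.eps_pos
  have hw := h.weight_pos
  have h1 : 0 ≤ ∑ v ∈ U, ε ^ 2 * w v * ind (1 / ε ^ 2 ≤ reachedMass w S {v} (U.erase v)) :=
    Finset.sum_nonneg fun v _ => by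
      have := hw v
      have := ind_nonneg (1 / ε ^ 2 ≤ reachedMass w S {v} (U.erase v))
      positivity
  have h2 : ∀ i, 0 ≤ ∑ v ∈ U, ε ^ 2 * w v * (2 / (1 / 2) ^ i) *
        ind (k ≤ extra S {v} (U.erase v) ∧
          (1 / 2) ^ i / 2 / ε ^ 2 ≤ reachedMass w S {v} (U.erase v) ∧
          reachedMass w S {v} (U.erase v) ≤ (1 / 2) ^ i / ε ^ 2) := fun i =>
    Finset.sum_nonneg fun v _ => mul_nonneg (by have := hw v; positivity) (ind_nonneg _)
  refine ind_le_of (add_nonneg h1 (Finset.sum_nonneg fun i _ => h2 i)) ?_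
  rintro ⟨C, hC, hk⟩
  have hCU := hC.2.1.1
  obtain ⟨v₀, hv₀⟩ := hC.1
  have hm : w v₀ ≤ ∑ i ∈ C, w i :=
    Finset.single_le_sum (f := w) (fun i _ => (hw i).le) hv₀
  set m := ∑ i ∈ C, w i with hmdef
  have hm0 : 0 < m := (hw v₀).trans_le hm
  rcases le_total (1 / ε ^ 2) m with hbig | hsmall
  · refine le_trans ?_ (le_add_of_nonneg_right (Finset.sum_nonneg fun i _ => h2 i))
    calc (1 : ℝ) ≤ ε ^ 2 * m := by rwa [div_le_iff₀' (by positivity)] at hbig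
      _ = ∑ v ∈ C, ε ^ 2 * w v * ind (1 / ε ^ 2 ≤ reachedMass w S {v} (U.erase v)) := by
        rw [hmdef, Finset.mul_sum]
        refine Finset.sum_congr rfl fun v hv => ?_
        rw [hC.reachedMass_eq hv, ind_of_true hbig, mul_one]
      _ ≤ _ := Finset.sum_le_sum_of_subset_of_nonneg hCU fun v _ _ =>
        mul_nonneg (by have := hw v; positivity) (ind_nonneg _)
  -- The dyadic scale of the component. Since m is at least one vertex weight, `hI` forces i < I.
  · obtain ⟨i, hi1, hi2⟩ := exists_nat_pow_near_of_lt_one (x := ε ^ 2 * m) (y := 1 / 2)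
      (by positivity) (by rwa [le_div_iff₀' (by positivity)] at hsmall) (by norm_num) (by norm_num)
    have hiI : i < I := by
      by_contra! hcon
      have h3 : (1 / 2 : ℝ) ^ i ≤ (1 / 2) ^ I := pow_le_pow_of_le_one (by norm_num) (by norm_num) hcon
      have h4 := hI v₀ (hCU hv₀)
      have : ε ^ 2 * w v₀ ≤ ε ^ 2 * m := by gcongr
      linarith
    refine le_trans ?_ (le_add_of_nonneg_left h1)
    refine le_trans ?_ (Finset.single_le_sum (fun i _ => h2 i) (Finset.mem_range.2 hiI))
    have hlow : (1 / 2) ^ i / 2 / ε ^ 2 ≤ m := by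
      rw [div_le_iff₀' (by positivity)]
      rw [pow_succ] at hi1
      linarith
    have hup : m ≤ (1 / 2) ^ i / ε ^ 2 := by rwa [le_div_iff₀' (by positivity)]
    have hr0 : (0 : ℝ) < (1 / 2) ^ i := by positivity
    calc (1 : ℝ) ≤ ε ^ 2 * m * (2 / (1 / 2) ^ i) := by
          rw [pow_succ] at hi1
          rw [mul_div_assoc', le_div_iff₀ hr0]
          linarith
      _ = ∑ v ∈ C, ε ^ 2 * w v * (2 / (1 / 2) ^ i) *
            ind (k ≤ extra S {v} (U.erase v) ∧
            (1 / 2) ^ i / 2 / ε ^ 2 ≤ reachedMass w S {v} (U.erase v) ∧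
            reachedMass w S {v} (U.erase v) ≤ (1 / 2) ^ i / ε ^ 2) := by
        rw [hmdef, Finset.mul_sum, Finset.sum_mul]
        refine Finset.sum_congr rfl fun v hv => ?_
        rw [hC.reachedMass_eq hv, hC.extra_eq hv, ind_of_true ⟨by linarith, hlow, hup⟩, mul_one]
      _ ≤ _ := Finset.sum_le_sum_of_subset_of_nonneg hCU fun v _ _ =>
        mul_nonneg (by have := hw v; positivity) (ind_nonneg _)

/-- The subcritical graph is unlikely to have a component of large excess. -/
lemma gexp_hasExcess_le (h : CriticalWindow w p ε f κ c₀)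
    (hU : p * ∑ i ∈ U, w i ^ 2 ≤ 1 - 3 * (f * ε)) {k : ℝ} (hk : 20 * f ≤ k) :
    gexp w p U (fun S => ind (HasExcess S U k)) ≤ 56 * Real.exp (-f) := by
  have hε := h.eps_pos
  have hf := h.one_le
  have hw := h.weight_pos
  -- I is not controlled, and need not be: the geometric sum over scales is at most 2 for every I.
  obtain ⟨I, hI⟩ : ∃ I : ℕ, ∀ v ∈ U, (1 / 2 : ℝ) ^ I < ε ^ 2 * w v := by
    refine ((Filter.eventually_all_finset U).2 fun v _ => ?_).exists (f := atTop)
    have := hw v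
    exact (tendsto_pow_atTop_nhds_zero_of_lt_one (by norm_num) (by norm_num)).eventually_lt_const
      (by positivity)
  have hb : ε ^ 3 * ∑ i ∈ U, w i ^ 2 ≤ 1 := by
    have h1 : 0 ≤ ∑ i ∈ U, w i ^ 2 := Finset.sum_nonneg fun i _ => sq_nonneg _
    have h2 := mul_le_mul_of_nonneg_right h.le_p h1
    have : 0 ≤ f * ε := by positivity
    linarith
  refine (gexp_mono hw h.p_pos.le fun S _ => h.ind_hasExcess_le hI).trans ?_
  have e1 : ∀ v ∈ U, gexp w p U (fun S => ε ^ 2 * w v *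
      ind (1 / ε ^ 2 ≤ reachedMass w S {v} (U.erase v))) ≤
      8 * Real.exp (-f) * (ε ^ 3 * w v ^ 2) := by
    intro v hv
    rw [gexp, bexp_mul_left]
    have h1 := h.mass_tail hU hv (y := 1 / ε ^ 2) (by positivity)
    have h2 : 2 * f * ε ^ 2 * (1 / ε ^ 2) = 2 * f := by field_simp
    rw [h2, div_eq_mul_inv] at h1
    have h3 := two_mul_exp_neg hf
    have h4 : Real.exp (-(2 * f)) ≤ Real.exp (-f) := Real.exp_le_exp.2 (by linarith)
    have hwv := hw v
    calc _ ≤ ε ^ 2 * w v * (4 * (ε * w v) * (2 * Real.exp (-f))) := by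
          refine mul_le_mul_of_nonneg_left (h1.trans ?_) (by positivity)
          exact mul_le_mul_of_nonneg_left (by linarith) (by positivity)
      _ = _ := by ring
  have e2 : ∀ i, ∀ v ∈ U, gexp w p U (fun S => ε ^ 2 * w v * (2 / (1 / 2) ^ i) *
        ind (k ≤ extra S {v} (U.erase v) ∧
          (1 / 2) ^ i / 2 / ε ^ 2 ≤ reachedMass w S {v} (U.erase v) ∧
          reachedMass w S {v} (U.erase v) ≤ (1 / 2) ^ i / ε ^ 2)) ≤
      (24 * Real.exp (-f)) * (1 / 2) ^ i * (ε ^ 3 * w v ^ 2) := by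
    intro i v hv
    rw [gexp, bexp_mul_left]
    have hwv := hw v
    calc _ ≤ ε ^ 2 * w v * (2 / (1 / 2) ^ i) *
          (12 * ((1 / 2) ^ i) ^ 2 * (ε * w v) * Real.exp (-f)) :=
          mul_le_mul_of_nonneg_left (h.excess_dyadic hU hv hk i) (by positivity)
      _ = _ := by field_simp; ring
  have hgeo : ∑ i ∈ Finset.range I, (1 / 2 : ℝ) ^ i ≤ 2 := by
    simpa using sum_geometric_two_le I
  unfold gexp at e1 e2 ⊢
  rw [bexp_add, bexp_sum, bexp_sum]
  simp only [bexp_sum]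
  have hE := Real.exp_pos (-f)
  have hb0 : 0 ≤ ε ^ 3 * ∑ i ∈ U, w i ^ 2 :=
    mul_nonneg (by positivity) (Finset.sum_nonneg fun i _ => sq_nonneg _)
  calc _ ≤ ∑ v ∈ U, 8 * Real.exp (-f) * (ε ^ 3 * w v ^ 2) + ∑ i ∈ Finset.range I, ∑ v ∈ U,
        (24 * Real.exp (-f)) * (1 / 2) ^ i * (ε ^ 3 * w v ^ 2) :=
      add_le_add (Finset.sum_le_sum e1)
        (Finset.sum_le_sum fun i _ => Finset.sum_le_sum (e2 i))
    _ = 8 * Real.exp (-f) * (ε ^ 3 * ∑ i ∈ U, w i ^ 2) + (24 * Real.exp (-f)) *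
        (∑ i ∈ Finset.range I, (1 / 2 : ℝ) ^ i) * (ε ^ 3 * ∑ i ∈ U, w i ^ 2) := by
      simp only [Finset.mul_sum, Finset.sum_mul]
      congr 1
      exact Finset.sum_comm
    _ ≤ 8 * Real.exp (-f) * 1 + (24 * Real.exp (-f)) * 2 * 1 := by gcongr
    _ = _ := by ring

end CriticalWindow
end Components

/-! ### Exploration of the supercritical graph -/

section Supercritical

lemma exists_subset_sum_near {V : Type*} [DecidableEq V] {w : V → ℝ} {M δ : ℝ} (hM : 0 ≤ M)
    (hδ : 0 ≤ δ) (hw : ∀ i, w i ≤ δ) (s : Finset V) (hs : M ≤ ∑ i ∈ s, w i) :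
    ∃ Q : Finset V, M ≤ ∑ i ∈ Q, w i ∧ ∑ i ∈ Q, w i ≤ M + δ := by
  induction s using Finset.induction_on with
  | empty => exact ⟨∅, hs, by simpa using add_nonneg hM hδ⟩
  | insert a s ha ih =>
    by_cases h : M ≤ ∑ i ∈ s, w i
    · exact ih h
    · refine ⟨insert a s, hs, ?_⟩
      rw [Finset.sum_insert ha]
      linarith [hw a]

/-- The surplus x - 1 only helps, so the case x = 1 decides: there the slopes -11 and 4 sum to -7,
well below -2, and u ≤ 1/100 absorbs the quadratic errors. -/
lemma exp_combination_le {u x : ℝ} (hu : 0 ≤ u) (hu1 : u ≤ 1 / 100) (hx : 1 ≤ x) :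
    Real.exp (-(11 * u)) * x + Real.exp (4 * u) ≤ Real.exp (-u) * (x + 1) := by
  have h1 := Real.abs_exp_sub_one_sub_id_le (x := -(11 * u))
    (by rw [abs_le]; constructor <;> linarith)
  have h2 := Real.abs_exp_sub_one_sub_id_le (x := 4 * u)
    (by rw [abs_le]; constructor <;> linarith)
  have h3 := Real.add_one_le_exp (-u)
  have h4 : Real.exp (-(11 * u)) ≤ Real.exp (-u) := Real.exp_le_exp.2 (by linarith)
  have h5 := (abs_le.1 h1).2
  have h6 := (abs_le.1 h2).2
  have h7 : Real.exp (-(11 * u)) + Real.exp (4 * u) ≤ 2 * Real.exp (-u) := by nlinarith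
  nlinarith [mul_le_mul_of_nonneg_right h4 (sub_nonneg.2 hx)]

variable {V : Type*} [Fintype V] {w : V → ℝ} {p ε f κ c₀ : ℝ}

namespace CriticalWindow

lemma p_mul_sum_sq_le (h : CriticalWindow w p ε f κ c₀) (U : Finset V) :
    p * ∑ i ∈ U, w i ^ 2 ≤ 1 + 3 * (f * ε) := by
  have hε := h.eps_pos
  have hf := h.one_le
  have h0 : ∑ i ∈ U, w i ^ 2 ≤ ∑ i, w i ^ 2 := Finset.sum_le_sum_of_subset_of_nonneg
    (Finset.subset_univ _) fun i _ _ => sq_nonneg _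
  have h1 : ε ≤ f * ε := le_mul_of_one_le_left hε.le hf
  have h2 : f * ε * ε ≤ f * ε := mul_le_of_le_one_right (by positivity) (by linarith [h.eps_le])
  calc p * ∑ i ∈ U, w i ^ 2 ≤ p * ∑ i, w i ^ 2 := mul_le_mul_of_nonneg_left h0 h.p_pos.le
    _ = (1 + f * ε) * (ε ^ 3 * ∑ i, w i ^ 2) := by rw [h.p_eq]; ring
    _ ≤ (1 + f * ε) * (1 + ε) := mul_le_mul_of_nonneg_left h.sum_sq_le (by positivity)
    _ ≤ _ := by linarith

/-- This bounds how much second moment the exploration can consume before the rest becomes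
subcritical. -/
lemma sum_sq_sub_le (h : CriticalWindow w p ε f κ c₀) :
    ε ^ 3 * (∑ i, w i ^ 2 - (1 - 3 * (f * ε)) / p) ≤ 5 * (f * ε) := by
  have hε := h.eps_pos
  have hf := h.one_le
  have h0 : 0 < 1 + f * ε := by positivity
  have h1 : ε ≤ f * ε := le_mul_of_one_le_left hε.le hf
  have h2 : ε ^ 3 * ((1 - 3 * (f * ε)) / p) = (1 - 3 * (f * ε)) / (1 + f * ε) := by
    rw [h.p_eq]; field_simp
  have h3 : 1 - 4 * (f * ε) ≤ (1 - 3 * (f * ε)) / (1 + f * ε) := by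
    rw [le_div_iff₀ h0]
    nlinarith [sq_nonneg (f * ε)]
  rw [mul_sub, h2]
  linarith [h.sum_sq_le]

variable [DecidableEq V] {U : Finset V}

/-- Since min(w, 1)³ ≤ w², the vertices outside U take away at most their second moment, which is at
most 5fε ≤ c₀/2 in units of ε^(-3). The truncation prevents a few heavy vertices, if found early,
from carrying the whole third moment. -/
lemma le_p_mul_sum_cube (h : CriticalWindow w p ε f κ c₀)
    (hU : 1 - 3 * (f * ε) ≤ p * ∑ i ∈ U, w i ^ 2) : c₀ / 2 ≤ p * ∑ i ∈ U, w i ^ 3 := by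
  have hε := h.eps_pos
  have hw := h.weight_pos
  have h1 : ∑ i, min (w i) 1 ^ 3 ≤ ∑ i ∈ U, w i ^ 3 + (∑ i, w i ^ 2 - ∑ i ∈ U, w i ^ 2) := by
    rw [← Finset.sum_sdiff (Finset.subset_univ U), ← Finset.sum_sdiff (Finset.subset_univ U)
      (f := fun i => w i ^ 2), add_sub_cancel_right, add_comm]
    refine add_le_add (Finset.sum_le_sum fun i _ => ?_) (Finset.sum_le_sum fun i _ => ?_)
    · exact pow_le_pow_left₀ (le_min (hw i).le zero_le_one) (min_le_left _ _) 3
    · have h2 : 0 ≤ min (w i) 1 := le_min (hw i).le zero_le_one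
      calc min (w i) 1 ^ 3 = min (w i) 1 ^ 2 * min (w i) 1 := by ring
        _ ≤ w i ^ 2 * 1 := mul_le_mul (pow_le_pow_left₀ h2 (min_le_left _ _) 2) (min_le_right _ _)
          h2 (sq_nonneg _)
        _ = _ := mul_one _
  have h2 : (1 - 3 * (f * ε)) / p ≤ ∑ i ∈ U, w i ^ 2 := by rwa [div_le_iff₀' h.p_pos]
  have h3 := h.sum_sq_sub_le
  have h4 : ε ^ 3 * ∑ i ∈ U, w i ^ 3 ≤ p * ∑ i ∈ U, w i ^ 3 := mul_le_mul_of_nonneg_right h.le_p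
    (Finset.sum_nonneg fun i _ => pow_nonneg (hw i).le 3)
  have h5 := mul_le_mul_of_nonneg_left h1 (pow_pos hε 3).le
  have h6 := mul_le_mul_of_nonneg_left h2 (pow_pos hε 3).le
  have h7 := h.le_sum_min
  have h8 := h.mul_eps_le'
  linarith

/-- For the tilt |τ| = ε/f the second-order terms are at most (3ε²/f)(2κ) ≤ ε², so only the linear
drift and the gain from l remain to be compared with A. -/
lemma step_le (h : CriticalWindow w p ε f κ c₀) {τ l A : ℝ} (hτ : |τ| = ε / f) (hl : 0 ≤ l)
    (hl' : l ≤ 80 * ε ^ 2 / c₀) (v : V)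
    (hA : τ * (p * ∑ i ∈ U, w i ^ 2) + ε ^ 2 - 3 / 8 * l * (p * ∑ i ∈ U, w i ^ 3) ≤ A) :
    bexp (fun j => edgeProb w p s(v, j)) U
        (fun T => Real.exp (τ * ∑ i ∈ T, w i - l * ∑ i ∈ T, w i ^ 2)) ≤ Real.exp (A * w v) := by
  have hε := h.eps_pos
  have hf := h.one_le
  have hc := h.c₀_pos
  have hθ : ε / f ≤ ε := div_le_self hε.le hf
  have hθ0 : 0 < ε / f := by positivity
  refine (bexp_exp_sum_le h.weight_pos h.p_pos.le (h.p_mul_mul_le v) (fun i => ?_) hl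
    fun i => ?_).trans (Real.exp_le_exp.2 ?_)
  · rw [hτ]
    have := mul_le_mul_of_nonneg_right hθ (h.weight_pos i).le
    linarith [h.max_le i]
  · calc l * w i ^ 2 ≤ 80 * ε ^ 2 / c₀ * w i ^ 2 := mul_le_mul_of_nonneg_right hl' (sq_nonneg _)
      _ = 80 * (ε * w i) ^ 2 / c₀ := by ring
      _ ≤ 1 / 8 := by
        rw [div_le_iff₀ hc]
        linarith [h.max_sq_le i]
  · rw [mul_comm]
    refine mul_le_mul_of_nonneg_right (le_trans ?_ hA) (h.weight_pos v).le
    have h1 : 2 * τ ^ 2 + |τ| * (p * w v) ≤ 3 * (ε ^ 2 / f) := by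
      have e1 : τ ^ 2 = (ε / f) ^ 2 := by rw [← sq_abs, hτ]
      have e2 : (ε / f) ^ 2 ≤ ε ^ 2 / f := by
        rw [div_pow, pow_two f, ← div_div]
        exact div_le_self (by positivity) hf
      have e3 : ε / f * (p * w v) ≤ ε ^ 2 / f := by
        calc ε / f * (p * w v) ≤ ε / f * ε := by
              refine mul_le_mul_of_nonneg_left ((h.p_mul_le v).trans ?_) hθ0.le
              nlinarith [h.eps_le]
          _ = _ := by ring
      rw [e1, hτ]
      linarith
    have h2 : (2 * τ ^ 2 + |τ| * (p * w v)) * (p * ∑ i ∈ U, w i ^ 3) ≤ ε ^ 2 := by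
      calc _ ≤ 3 * (ε ^ 2 / f) * (2 * κ) :=
            mul_le_mul h1 (h.p_mul_sum_cube_le U) (h.p_mul_sum_cube_nonneg U) (by positivity)
        _ = ε ^ 2 * (6 * κ / f) := by ring
        _ ≤ ε ^ 2 * 1 := by
          refine mul_le_mul_of_nonneg_left ?_ (sq_nonneg _)
          rw [div_le_one (by linarith)]
          linarith [h.kappa_le, h.kappa_pos]
        _ = _ := mul_one _
    linarith

/-- While p ∑_U w² exceeds 1 - 3fε, the active weight may grow, but the loss of second moment makes
the first summand decay fast enough to pay for both. Below that level the active weight decays by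
itself. The summand 1 keeps the potential at least 1 when the exploration ends. -/
lemma potential_step_le (h : CriticalWindow w p ε f κ c₀) (v : V) (U : Finset V) :
    bexp (fun j => edgeProb w p s(v, j)) U (fun T => Real.exp (ε / f * ∑ i ∈ T, w i) *
        (Real.exp (80 * ε ^ 2 / c₀ * (∑ i ∈ U, w i ^ 2 - ∑ i ∈ T, w i ^ 2 -
          (1 - 3 * (f * ε)) / p)) + 1)) ≤
      Real.exp ((ε / f - ε ^ 2) * w v) *
        (Real.exp (80 * ε ^ 2 / c₀ * (∑ i ∈ U, w i ^ 2 - (1 - 3 * (f * ε)) / p)) + 1) := by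
  have hε := h.eps_pos
  have hf := h.one_le
  have hc := h.c₀_pos
  have hp := h.p_pos
  have hθ0 : 0 < ε / f := by positivity
  have hθf : ε / f * (3 * (f * ε)) = 3 * ε ^ 2 := by field_simp
  have hwv := h.weight_pos v
  set l := 80 * ε ^ 2 / c₀ with hl
  set β := (1 - 3 * (f * ε)) / p with hβ
  have hl0 : 0 ≤ l := by positivity
  have hb := mul_le_mul_of_nonneg_left (h.p_mul_sum_sq_le U) hθ0.le
  rcases le_total (p * ∑ i ∈ U, w i ^ 2) (1 - 3 * (f * ε)) with hU | hU
  · have h1 := h.step_le (τ := ε / f) (l := 0) (A := ε / f - 2 * ε ^ 2) (U := U)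
      (abs_of_pos hθ0) le_rfl hl0 v (by
        have := mul_le_mul_of_nonneg_left hU hθ0.le
        linarith)
    simp only [zero_mul, sub_zero] at h1
    have h2 : bexp (fun j => edgeProb w p s(v, j)) U (fun T => Real.exp (ε / f * ∑ i ∈ T, w i) *
        (Real.exp (l * (∑ i ∈ U, w i ^ 2 - ∑ i ∈ T, w i ^ 2 - β)) + 1)) ≤
        (Real.exp (l * (∑ i ∈ U, w i ^ 2 - β)) + 1) *
        bexp (fun j => edgeProb w p s(v, j)) U (fun T => Real.exp (ε / f * ∑ i ∈ T, w i)) := by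
      rw [← bexp_mul_left]
      refine bexp_mono (fun e => edgeProb_nonneg h.weight_pos hp.le _)
        (fun e => edgeProb_le_one _) fun T _ => ?_
      rw [mul_comm]
      refine mul_le_mul_of_nonneg_right ?_ (Real.exp_pos _).le
      have : 0 ≤ ∑ i ∈ T, w i ^ 2 := Finset.sum_nonneg fun i _ => sq_nonneg _
      gcongr
      linarith
    refine h2.trans ?_
    rw [mul_comm]
    refine mul_le_mul_of_nonneg_right (h1.trans (Real.exp_le_exp.2 ?_)) (by positivity)
    gcongr
    nlinarith [sq_nonneg ε]
  · have h3 := h.le_p_mul_sum_cube hU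
    have h1 := h.step_le (τ := ε / f) (l := 0) (A := ε / f + 4 * ε ^ 2) (U := U)
      (abs_of_pos hθ0) le_rfl hl0 v (by linarith)
    -- The constant 80 in l gives 3/8 · 80 · 1/2 = 15, which turns the drift +4ε² into -11ε².
    have hl3 : 15 * ε ^ 2 ≤ 3 / 8 * l * (p * ∑ i ∈ U, w i ^ 3) := by
      calc 15 * ε ^ 2 = 3 / 8 * l * (c₀ / 2) := by rw [hl]; field_simp; norm_num
        _ ≤ _ := mul_le_mul_of_nonneg_left h3 (by positivity)
    have h2 := h.step_le (τ := ε / f) (l := l) (A := ε / f - 11 * ε ^ 2) (U := U)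
      (abs_of_pos hθ0) hl0 le_rfl v (by linarith)
    simp only [zero_mul, sub_zero] at h1
    have e1 : bexp (fun j => edgeProb w p s(v, j)) U (fun T => Real.exp (ε / f * ∑ i ∈ T, w i) *
        (Real.exp (l * (∑ i ∈ U, w i ^ 2 - ∑ i ∈ T, w i ^ 2 - β)) + 1)) =
        Real.exp (l * (∑ i ∈ U, w i ^ 2 - β)) * bexp (fun j => edgeProb w p s(v, j)) U
          (fun T => Real.exp (ε / f * ∑ i ∈ T, w i - l * ∑ i ∈ T, w i ^ 2)) +
        bexp (fun j => edgeProb w p s(v, j)) U (fun T => Real.exp (ε / f * ∑ i ∈ T, w i)) := by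
      rw [← bexp_mul_left, ← bexp_add]
      refine bexp_congr fun T _ => ?_
      rw [mul_add, mul_one, ← Real.exp_add, ← Real.exp_add]
      ring_nf
    rw [e1]
    have hx : 1 ≤ Real.exp (l * (∑ i ∈ U, w i ^ 2 - β)) := by
      refine Real.one_le_exp (mul_nonneg hl0 (sub_nonneg.2 ?_))
      rwa [hβ, div_le_iff₀' hp]
    set x := Real.exp (l * (∑ i ∈ U, w i ^ 2 - β))
    have hu : ε ^ 2 * w v ≤ 1 / 100 := by
      have := h.max_le v
      have := h.eps_le
      calc ε ^ 2 * w v = ε * (ε * w v) := by ring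
        _ ≤ 1 / 10 * (1 / 10) := by gcongr
        _ = _ := by norm_num
    have h4 := exp_combination_le (u := ε ^ 2 * w v) (by positivity) hu hx
    calc _ ≤ x * Real.exp ((ε / f - 11 * ε ^ 2) * w v) + Real.exp ((ε / f + 4 * ε ^ 2) * w v) := by
          gcongr
      _ = Real.exp (ε / f * w v) *
          (Real.exp (-(11 * (ε ^ 2 * w v))) * x + Real.exp (4 * (ε ^ 2 * w v))) := by
        have e3 : Real.exp ((ε / f - 11 * ε ^ 2) * w v) =
            Real.exp (ε / f * w v) * Real.exp (-(11 * (ε ^ 2 * w v))) := by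
          rw [← Real.exp_add]; ring_nf
        have e4 : Real.exp ((ε / f + 4 * ε ^ 2) * w v) =
            Real.exp (ε / f * w v) * Real.exp (4 * (ε ^ 2 * w v)) := by
          rw [← Real.exp_add]; ring_nf
        rw [e3, e4]; ring
      _ ≤ Real.exp (ε / f * w v) * (Real.exp (-(ε ^ 2 * w v)) * (x + 1)) := by gcongr
      _ = _ := by rw [← mul_assoc, ← Real.exp_add]; ring_nf

/-- The exploration started from `Q` is unlikely to find many extra edges. -/
lemma gexp_extra_le (h : CriticalWindow w p ε f κ c₀) {B : ℝ} (hB : 1 ≤ B)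
    {Q U : Finset V} (hQU : Disjoint Q U) (k : ℝ) :
    gexp w p (Q ∪ U) (fun S => ind (k ≤ extra S Q U)) ≤
      (Real.exp (-(k / (4 * B * f ^ 2))) + Real.exp (-(B * f))) *
      (Real.exp (ε / f * ∑ i ∈ Q, w i) *
        (Real.exp (80 * ε ^ 2 / c₀ * (∑ i ∈ U, w i ^ 2 - (1 - 3 * (f * ε)) / p)) + 1)) := by
  have hε := h.eps_pos
  have hf := h.one_le
  have hp := h.p_pos
  have hw := h.weight_pos
  have hf2 : 1 ≤ f ^ 2 := one_le_pow₀ hf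
  -- Chosen so that, at active weight at most Bf²/ε, the surplus edges at v cost at most a factor
  -- exp(ε² w_v), exactly the decay given by `potential_step_le`.
  set γ := 1 / (4 * B * f ^ 2) with hγ
  have hγ0 : 0 ≤ γ := by positivity
  have hγ1 : γ ≤ 1 := by
    rw [hγ, div_le_one (by positivity)]
    nlinarith
  set l := 80 * ε ^ 2 / c₀ with hl
  set β := (1 - 3 * (f * ε)) / p with hβ
  have key := gexp_le_of_step (U₀ := Finset.univ) hw hp.le
    (F := fun (k : ℝ) S Q U => ind (k ≤ extra S Q U))
    (B := fun k Q U => (Real.exp (-(γ * k)) + Real.exp (-(B * f))) *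
      (Real.exp (ε / f * ∑ i ∈ Q, w i) * (Real.exp (l * (∑ i ∈ U, w i ^ 2 - β)) + 1)))
    ?_ ?_ k Q U hQU (Finset.subset_univ _)
  · rw [show k / (4 * B * f ^ 2) = γ * k by rw [hγ]; ring]
    exact key
  · intro k U _
    simp only [extra_empty]
    rw [gexp, bexp_const]
    refine ind_le_of (by positivity) fun hk => ?_
    have h1 : 1 ≤ Real.exp (-(γ * k)) :=
      Real.one_le_exp (by have := mul_nonneg hγ0 (neg_nonneg.2 hk); linarith)
    have h2 := Real.exp_pos (-(B * f))
    have h3 := Real.exp_pos (l * (∑ i ∈ U, w i ^ 2 - β))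
    simp only [Finset.sum_empty, mul_zero, Real.exp_zero, one_mul]
    exact one_le_mul_of_one_le_of_one_le (by linarith) (by linarith)
  · intro k v Q U hv hQU _
    have hvQ : v ∉ Q := fun h => hv (Finset.mem_union_left _ h)
    -- Above this level, e^(-Bf) times the active-weight factor is already at least 1.
    by_cases ha : B * f ^ 2 / ε < ∑ i ∈ insert v Q, w i
    · left
      refine (gexp_le_one hw hp.le fun S _ => ind_le_one _).trans ?_
      have h1 : 1 ≤ Real.exp (-(B * f)) * Real.exp (ε / f * ∑ i ∈ insert v Q, w i) := by
        rw [← Real.exp_add]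
        refine Real.one_le_exp ?_
        have : B * f = ε / f * (B * f ^ 2 / ε) := by field_simp
        have := mul_le_mul_of_nonneg_left ha.le (by positivity : 0 ≤ ε / f)
        linarith
      have h2 := Real.exp_pos (-(γ * k))
      have h3 := Real.exp_pos (l * (∑ i ∈ U, w i ^ 2 - β))
      have h4 := Real.exp_pos (ε / f * ∑ i ∈ insert v Q, w i)
      calc (1 : ℝ) ≤ Real.exp (-(B * f)) * Real.exp (ε / f * ∑ i ∈ insert v Q, w i) := h1
        _ ≤ (Real.exp (-(γ * k)) + Real.exp (-(B * f))) *
          (Real.exp (ε / f * ∑ i ∈ insert v Q, w i) *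
            (Real.exp (l * (∑ i ∈ U, w i ^ 2 - β)) + 1)) := by
          gcongr
          · linarith
          · exact le_mul_of_one_le_right h4.le (by linarith)
    rw [not_lt] at ha
    refine Or.inr ⟨fun T => k - (Q ∩ T).card, fun T hT S hS => ?_, ?_⟩
    · rw [extra_star hv hQU hS]
      exact ind_mono fun h => by linarith
    · have hQle : ∑ i ∈ Q, w i ≤ B * f ^ 2 / ε := by
        rw [Finset.sum_insert hvQ] at ha
        linarith [hw v]
      have hfirst : bexp (fun j => edgeProb w p s(v, j)) Q (fun T => Real.exp (γ * T.card)) ≤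
          Real.exp (ε ^ 2 * w v) := by
        refine (bexp_exp_card_le hw hp.le hγ0 v Q).trans (Real.exp_le_exp.2 ?_)
        have h1 : Real.exp γ - 1 ≤ 2 * γ := by
          have := Real.abs_exp_sub_one_sub_id_le (x := γ) (by rwa [abs_of_nonneg hγ0])
          nlinarith [(abs_le.1 this).2]
        have h2 := h.p_le
        have h3 := hw v
        have h4 : 0 ≤ ∑ i ∈ Q, w i := Finset.sum_nonneg fun i _ => (hw i).le
        calc (Real.exp γ - 1) * p * w v * ∑ i ∈ Q, w i
            ≤ 2 * γ * (2 * ε ^ 3) * w v * (B * f ^ 2 / ε) := by gcongr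
          _ = ε ^ 2 * w v := by rw [hγ]; field_simp; norm_num
      have hsecond := h.potential_step_le v U
      set G : Finset V → ℝ := fun T => Real.exp (ε / f * ∑ i ∈ T, w i) *
        (Real.exp (l * (∑ i ∈ U, w i ^ 2 - ∑ i ∈ T, w i ^ 2 - β)) + 1) with hG
      set K := Real.exp (-(γ * k)) + Real.exp (-(B * f)) with hK
      have hK0 : 0 < K := by positivity
      set x := Real.exp (l * (∑ i ∈ U, w i ^ 2 - β))
      calc _ ≤ bexp (fun j => edgeProb w p s(v, j)) (Q ∪ U) (fun T =>
            K * Real.exp (ε / f * ∑ i ∈ Q, w i) *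
              (Real.exp (γ * (Q ∩ T).card) * G (U ∩ T))) := by
            refine bexp_mono (fun e => edgeProb_nonneg hw hp.le _)
              (fun e => edgeProb_le_one _) fun T _ => ?_
            have e1 : Real.exp (-(γ * (k - (Q ∩ T).card))) + Real.exp (-(B * f)) ≤
                K * Real.exp (γ * (Q ∩ T).card) := by
              have : 1 ≤ Real.exp (γ * (Q ∩ T).card) := Real.one_le_exp (by positivity)
              rw [hK, add_mul, ← Real.exp_add]
              refine add_le_add (le_of_eq (by ring_nf)) ?_
              exact le_mul_of_one_le_right (Real.exp_pos _).le this
            rw [sum_union_inter hQU, sum_sdiff_inter, mul_add (ε / f), Real.exp_add]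
            calc _ ≤ K * Real.exp (γ * (Q ∩ T).card) * (Real.exp (ε / f * ∑ i ∈ Q, w i) *
                  Real.exp (ε / f * ∑ i ∈ U ∩ T, w i) *
                  (Real.exp (l * (∑ i ∈ U, w i ^ 2 - ∑ i ∈ U ∩ T, w i ^ 2 - β)) + 1)) :=
                  mul_le_mul_of_nonneg_right e1 (by positivity)
              _ = _ := by simp only [hG]; ring
        _ = K * Real.exp (ε / f * ∑ i ∈ Q, w i) *
            (bexp (fun j => edgeProb w p s(v, j)) Q (fun T => Real.exp (γ * T.card)) *
              bexp (fun j => edgeProb w p s(v, j)) U G) := by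
            rw [bexp_mul_left, bexp_union_inter hQU (fun T => Real.exp (γ * T.card)) G]
        _ ≤ K * Real.exp (ε / f * ∑ i ∈ Q, w i) *
            (Real.exp (ε ^ 2 * w v) * (Real.exp ((ε / f - ε ^ 2) * w v) * (x + 1))) := by
            refine mul_le_mul_of_nonneg_left (mul_le_mul hfirst hsecond ?_ (Real.exp_pos _).le)
              (by positivity)
            rw [← bexp_const (q := fun j => edgeProb w p s(v, j)) (A := U) 0]
            exact bexp_mono (fun e => edgeProb_nonneg hw hp.le _)
              (fun e => edgeProb_le_one _) fun T _ => by positivity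
        _ = K * (Real.exp (ε / f * ∑ i ∈ insert v Q, w i) * (x + 1)) := by
            rw [Finset.sum_insert hvQ, ← mul_assoc (Real.exp (ε ^ 2 * w v)), ← Real.exp_add,
              mul_assoc K, ← mul_assoc (Real.exp (ε / f * ∑ i ∈ Q, w i)), ← Real.exp_add]
            ring_nf

/-- The exploration reveals no edge inside the unreached set, which is therefore a fresh graph on a
subset of U, still subcritical. Hence a constant bound propagates. -/
lemma gexp_hasExcess_unreached_le_const (h : CriticalWindow w p ε f κ c₀) {k ρ : ℝ}
    (hρ : ∀ U : Finset V, p * ∑ i ∈ U, w i ^ 2 ≤ 1 - 3 * (f * ε) →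
      gexp w p U (fun S => ind (HasExcess S U k)) ≤ ρ)
    {Q U : Finset V} (hQU : Disjoint Q U) (hU : p * ∑ i ∈ U, w i ^ 2 ≤ 1 - 3 * (f * ε)) :
    gexp w p (Q ∪ U) (fun S => ind (HasExcess S (unreached S Q U) k)) ≤ ρ := by
  refine gexp_le_of_step (U₀ := U) h.weight_pos h.p_pos.le
    (F := fun (_ : Unit) S Q U => ind (HasExcess S (unreached S Q U) k))
    (B := fun _ _ _ => ρ) ?_ ?_ () Q U hQU subset_rfl
  · intro _ U' hU'
    simp only [unreached_empty]
    exact hρ U' (le_trans (mul_le_mul_of_nonneg_left (Finset.sum_le_sum_of_subset_of_nonneg hU'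
      fun i _ _ => sq_nonneg _) h.p_pos.le) hU)
  · intro _ v Q U hv hQU _
    refine Or.inr ⟨fun _ => (), fun T hT S hS => ?_, (bexp_const _).le⟩
    rw [unreached_star hv hS]
    refine ind_mono (hasExcess_star fun hvR => hv ?_).1
    exact Finset.mem_union_right _ (Finset.sdiff_subset (unreached_subset hvR))

/-- The part of the graph not connected to `Q` is unlikely to have a component of large excess. -/
lemma gexp_hasExcess_unreached_le (h : CriticalWindow w p ε f κ c₀) {k ρ : ℝ} (hρ0 : 0 ≤ ρ)
    (hρ : ∀ U : Finset V, p * ∑ i ∈ U, w i ^ 2 ≤ 1 - 3 * (f * ε) →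
      gexp w p U (fun S => ind (HasExcess S U k)) ≤ ρ)
    {Q U : Finset V} (hQU : Disjoint Q U) :
    gexp w p (Q ∪ U) (fun S => ind (HasExcess S (unreached S Q U) k)) ≤
      Real.exp (-(ε / f * ∑ i ∈ Q, w i) +
        80 * ε ^ 2 / c₀ * (∑ i ∈ U, w i ^ 2 - (1 - 3 * (f * ε)) / p)) + ρ := by
  have hε := h.eps_pos
  have hf := h.one_le
  have hp := h.p_pos
  have hw := h.weight_pos
  have hc := h.c₀_pos
  have hθ0 : 0 < ε / f := by positivity
  have hθf : ε / f * (3 * (f * ε)) = 3 * ε ^ 2 := by field_simp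
  set l := 80 * ε ^ 2 / c₀ with hl
  set β := (1 - 3 * (f * ε)) / p with hβ
  have hl0 : 0 ≤ l := by positivity
  refine gexp_le_of_step (U₀ := Finset.univ) hw hp.le
    (F := fun (_ : Unit) S Q U => ind (HasExcess S (unreached S Q U) k))
    (B := fun _ Q U => Real.exp (-(ε / f * ∑ i ∈ Q, w i) + l * (∑ i ∈ U, w i ^ 2 - β)) + ρ)
    ?_ ?_ () Q U hQU (Finset.subset_univ _)
  · intro _ U _
    rcases le_total (p * ∑ i ∈ U, w i ^ 2) (1 - 3 * (f * ε)) with hU | hU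
    · have := h.gexp_hasExcess_unreached_le_const hρ (Finset.disjoint_empty_left U) hU
      rw [Finset.empty_union] at this
      exact this.trans (le_add_of_nonneg_left (Real.exp_pos _).le)
    -- The exploration died too early; the exponential is at least 1 in such a state.
    · refine (gexp_le_one hw hp.le fun S _ => ind_le_one _).trans ?_
      have hx : 1 ≤ Real.exp (-(ε / f * ∑ i ∈ ∅, w i) + l * (∑ i ∈ U, w i ^ 2 - β)) := by
        rw [Finset.sum_empty, mul_zero, neg_zero, zero_add]
        refine Real.one_le_exp (mul_nonneg hl0 (sub_nonneg.2 ?_))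
        rwa [hβ, div_le_iff₀' hp]
      linarith
  · intro _ v Q U hv hQU _
    have hvQ : v ∉ Q := fun h => hv (Finset.mem_union_left _ h)
    rcases le_total (p * ∑ i ∈ U, w i ^ 2) (1 - 3 * (f * ε)) with hU | hU
    · left
      have hvU : v ∉ U := fun h => hv (Finset.mem_union_right _ h)
      exact (h.gexp_hasExcess_unreached_le_const hρ
        (Finset.disjoint_insert_left.2 ⟨hvU, hQU⟩) hU).trans
        (le_add_of_nonneg_left (Real.exp_pos _).le)
    · refine Or.inr ⟨fun _ => (), fun T hT S hS => ?_, ?_⟩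
      · rw [unreached_star hv hS]
        refine ind_mono (hasExcess_star fun hvR => hv ?_).1
        exact Finset.mem_union_right _ (Finset.sdiff_subset (unreached_subset hvR))
      · have hl3 : 15 * ε ^ 2 ≤ 3 / 8 * l * (p * ∑ i ∈ U, w i ^ 3) := by
          calc 15 * ε ^ 2 = 3 / 8 * l * (c₀ / 2) := by rw [hl]; field_simp; norm_num
            _ ≤ _ := mul_le_mul_of_nonneg_left (h.le_p_mul_sum_cube hU) (by positivity)
        have hb := mul_le_mul_of_nonneg_left hU hθ0.le
        -- The drift is at most -ε/f + 3ε² + ε² - 15ε² ≤ -ε/f.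
        have h2 := h.step_le (τ := -(ε / f)) (l := l) (A := -(ε / f)) (U := U)
          (by rw [abs_neg, abs_of_pos hθ0]) hl0 le_rfl v (by nlinarith [sq_nonneg ε])
        set K := Real.exp (-(ε / f * ∑ i ∈ Q, w i) + l * (∑ i ∈ U, w i ^ 2 - β)) with hK
        calc _ = K * bexp (fun j => edgeProb w p s(v, j)) (Q ∪ U) (fun T =>
              1 * Real.exp (-(ε / f) * ∑ i ∈ U ∩ T, w i - l * ∑ i ∈ U ∩ T, w i ^ 2)) + ρ := by
              rw [bexp_add, bexp_const, ← bexp_mul_left]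
              congr 1
              refine bexp_congr fun T _ => ?_
              rw [sum_union_inter hQU, sum_sdiff_inter, one_mul, hK, ← Real.exp_add]
              ring_nf
          _ ≤ K * Real.exp (-(ε / f) * w v) + ρ := by
              rw [bexp_union_inter hQU (fun _ => 1) (fun T =>
                Real.exp (-(ε / f) * ∑ i ∈ T, w i - l * ∑ i ∈ T, w i ^ 2)), bexp_const, one_mul]
              gcongr
          _ = _ := by
              rw [hK, ← Real.exp_add, Finset.sum_insert hvQ]
              ring_nf

/-- In the critical window, components of excess of order `f ^ 3` are unlikely. -/
theorem gexp_hasExcess_univ_le (h : CriticalWindow w p ε f κ c₀)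
    (hsmall : (400 / c₀ + 1) * (f * ε) ^ 2 ≤ 1) {k : ℝ}
    (hk : 4 * (2 * (400 / c₀) + 20) ^ 2 * f ^ 3 ≤ k) :
    gexp w p Finset.univ (fun S => ind (HasExcess S Finset.univ k)) ≤ 61 * Real.exp (-f) := by
  have hε := h.eps_pos
  have hf := h.one_le
  have hp := h.p_pos
  have hw := h.weight_pos
  have hc := h.c₀_pos
  set L := 400 / c₀ with hL
  have hL0 : 0 < L := by positivity
  set B := 2 * L + 20 with hB
  have hf3 : f ≤ f ^ 3 := le_self_pow₀ hf (by norm_num)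
  have hk20 : 20 * f ≤ k := by
    have : (20 : ℝ) ≤ 4 * B ^ 2 := by nlinarith
    calc 20 * f ≤ 4 * B ^ 2 * f ^ 3 := by gcongr
      _ ≤ k := hk
  -- In units of f/ε this weight is about (L + 1)f, which beats the second-moment budget d ≤ Lf by
  -- f. Assumption `hsmall` says that the total weight suffices.
  obtain ⟨Q, hQ1, hQ2⟩ := exists_subset_sum_near (w := w) (M := (L + 1) * f ^ 2 / ε)
    (δ := 1 / ε) (by positivity) (by positivity)
    (fun i => by rw [le_div_iff₀' hε]; linarith [h.max_le i]) Finset.univ (by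
      rw [div_le_iff₀' hε]
      refine le_of_mul_le_mul_left ?_ (pow_pos hε 2)
      calc ε ^ 2 * ((L + 1) * f ^ 2) = (L + 1) * (f * ε) ^ 2 := by ring
        _ ≤ 1 := hsmall
        _ = ε ^ 2 * (ε * ∑ i, w i) := by rw [← h.sum_eq]; ring)
  set U := Finset.univ \ Q with hUdef
  have hQU : Disjoint Q U := Finset.disjoint_sdiff
  have huniv : Q ∪ U = Finset.univ := Finset.union_sdiff_of_subset (Finset.subset_univ _)
  set a := ε / f * ∑ i ∈ Q, w i with ha
  have hθ0 : 0 < ε / f := by positivity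
  have ha1 : (L + 1) * f ≤ a := by
    calc (L + 1) * f = ε / f * ((L + 1) * f ^ 2 / ε) := by field_simp
      _ ≤ a := mul_le_mul_of_nonneg_left hQ1 hθ0.le
  have ha2 : a ≤ (L + 1) * f + f := by
    calc a ≤ ε / f * ((L + 1) * f ^ 2 / ε + 1 / ε) := mul_le_mul_of_nonneg_left hQ2 hθ0.le
      _ = (L + 1) * f + 1 / f := by field_simp
      _ ≤ _ := by
        have : 1 / f ≤ 1 := (div_le_one (by linarith)).2 hf
        linarith
  set d := 80 * ε ^ 2 / c₀ * (∑ i ∈ U, w i ^ 2 - (1 - 3 * (f * ε)) / p) with hd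
  have hd1 : d ≤ L * f := by
    have h0 : ∑ i ∈ U, w i ^ 2 ≤ ∑ i, w i ^ 2 := Finset.sum_le_sum_of_subset_of_nonneg
      (Finset.subset_univ _) fun i _ _ => sq_nonneg _
    have h1 : ε ^ 3 * (∑ i ∈ U, w i ^ 2 - (1 - 3 * (f * ε)) / p) ≤ 5 * (f * ε) :=
      le_trans (by gcongr) h.sum_sq_sub_le
    calc d = 80 / c₀ / ε * (ε ^ 3 * (∑ i ∈ U, w i ^ 2 - (1 - 3 * (f * ε)) / p)) := by
          rw [hd]; field_simp
      _ ≤ 80 / c₀ / ε * (5 * (f * ε)) := mul_le_mul_of_nonneg_left h1 (by positivity)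
      _ = L * f := by rw [hL]; field_simp; norm_num
  have hI := h.gexp_extra_le (B := B) (by linarith) hQU k
  have hII := h.gexp_hasExcess_unreached_le (k := k) (by positivity)
    (fun U hU => h.gexp_hasExcess_le hU hk20) hQU
  rw [huniv] at hI hII
  have hI' : (Real.exp (-(k / (4 * B * f ^ 2))) + Real.exp (-(B * f))) *
      (Real.exp a * (Real.exp d + 1)) ≤ 4 * Real.exp (-f) := by
    have e1 : Real.exp (-(k / (4 * B * f ^ 2))) ≤ Real.exp (-(B * f)) := by
      refine Real.exp_le_exp.2 (neg_le_neg ?_)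
      rw [le_div_iff₀ (by positivity)]
      calc B * f * (4 * B * f ^ 2) = 4 * B ^ 2 * f ^ 3 := by ring
        _ ≤ k := hk
    have e2 : Real.exp d + 1 ≤ 2 * Real.exp (L * f) := by
      have := Real.exp_le_exp.2 hd1
      have := Real.one_le_exp (show 0 ≤ L * f by positivity)
      linarith
    calc _ ≤ 2 * Real.exp (-(B * f)) * (Real.exp ((L + 1) * f + f) * (2 * Real.exp (L * f))) := by
          gcongr
          linarith
      _ = 4 * Real.exp (-(B * f) + ((L + 1) * f + f) + L * f) := by
          rw [Real.exp_add _ (L * f), Real.exp_add (-(B * f))]; ring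
      _ ≤ _ := by
          -- It remains to compare exponents: with B = 2L + 20 the left one equals -18f.
          gcongr
          rw [hB]
          nlinarith
  have hII' : Real.exp (-a + d) ≤ Real.exp (-f) := Real.exp_le_exp.2 (by linarith)
  calc _ ≤ gexp w p Finset.univ (fun S => ind (k ≤ extra S Q U) +
        ind (HasExcess S (unreached S Q U) k)) := by
        refine gexp_mono hw hp.le fun S hS => ?_
        refine ind_le_of (add_nonneg (ind_nonneg _) (ind_nonneg _)) fun hex => ?_
        rw [← huniv] at hS hex
        rcases hex.extra_or_unreached hQU hS with h1 | h1
        · rw [ind_of_true h1]; linarith [ind_nonneg (HasExcess S (unreached S Q U) k)]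
        · rw [ind_of_true h1]; linarith [ind_nonneg (k ≤ extra S Q U)]
    _ ≤ 4 * Real.exp (-f) + (Real.exp (-f) + 56 * Real.exp (-f)) := by
        rw [gexp, bexp_add]
        exact add_le_add (hI.trans hI') (hII.trans (by linarith))
    _ = _ := by ring

end CriticalWindow
end Supercritical

/-! ### The random graph of the capacities -/

section Capacities

/-- Removing the edges outside a spanning tree bounds the excess. -/
lemma excess_add_card_le {W : Type*} [Finite W] {H : SimpleGraph W} (hH : H.Connected) :
    excess H + Nat.card W ≤ H.edgeSet.ncard + 1 := by
  classical
  have := Fintype.ofFinite W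
  obtain ⟨T, hTH, hT⟩ := hH.exists_isTree_le
  have hsub : T.edgeSet ⊆ H.edgeSet := SimpleGraph.edgeSet_mono hTH
  have h1 : excess H ≤ (H.edgeSet \ T.edgeSet).ncard := by
    refine Nat.sInf_le ⟨_, Set.sdiff_subset, rfl, ?_⟩
    have : H.deleteEdges (H.edgeSet \ T.edgeSet) = T := by
      ext a b
      rw [SimpleGraph.deleteEdges_adj, Set.mem_sdiff, SimpleGraph.mem_edgeSet,
        SimpleGraph.mem_edgeSet]
      exact ⟨fun h => by tauto, fun h => ⟨hTH h, fun h2 => h2.2 h⟩⟩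
    rwa [this]
  have h2 := hT.card_edgeFinset
  have h3 : T.edgeSet.ncard + 1 = Nat.card W := by
    rw [Nat.card_eq_fintype_card, ← h2, ← SimpleGraph.coe_edgeFinset, Set.ncard_coe_finset]
  have h4 := Set.ncard_sdiff_add_ncard_of_subset hsub
  omega

variable {n : ℕ}

open Classical in
/-- The potential edges of capacity at most `p`. -/
def presentEdges (E : PotentialEdge n → ℝ) (p : ℝ) : Finset (Sym2 (Fin n)) :=
  Finset.univ.filter fun e => ∃ h : ¬ e.IsDiag, E ⟨e, h⟩ ≤ p

lemma mem_presentEdges {E : PotentialEdge n → ℝ} {p : ℝ} {e : Sym2 (Fin n)} :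
    e ∈ presentEdges E p ↔ ∃ h : ¬ e.IsDiag, E ⟨e, h⟩ ≤ p := by
  simp [presentEdges]

lemma graphAt_adj {E : PotentialEdge n → ℝ} {p : ℝ} {x y : Fin n} :
    (graphAt E p).Adj x y ↔ s(x, y) ∈ presentEdges E p := by
  rw [graphAt, SimpleGraph.fromEdgeSet_adj, mem_presentEdges]
  exact ⟨fun h => h.1, fun h => ⟨h, fun hxy => h.1 (by simp [hxy])⟩⟩

/-- Passes from walks to closed sets: a nonempty closed subset of the component absorbs every walk
from one of its points. The edge inequality comes from `excess_add_card_le`. -/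
lemma hasExcess_presentEdges {E : PotentialEdge n → ℝ} {p k : ℝ}
    (c : (graphAt E p).ConnectedComponent) (hk : k ≤ (excess c.toSimpleGraph : ℝ)) :
    HasExcess (presentEdges E p) Finset.univ k := by
  classical
  set C : Finset (Fin n) := c.supp.toFinset with hC
  have hmem : ∀ x, x ∈ C ↔ (graphAt E p).connectedComponentMk x = c := fun x => by simp [hC]
  refine ⟨C, ⟨?_, ⟨Finset.subset_univ _, fun x hx y _ hxy => ?_⟩, fun D hDC hD => ?_⟩, ?_⟩
  · obtain ⟨x, hx⟩ := c.nonempty_supp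
    exact ⟨x, by simpa [hC] using hx⟩
  · rw [hmem] at hx ⊢
    rw [← hx]
    exact (SimpleGraph.ConnectedComponent.connectedComponentMk_eq_of_adj
      (graphAt_adj.2 hxy)).symm
  · rcases D.eq_empty_or_nonempty with h | ⟨x, hx⟩
    · exact Or.inl h
    · refine Or.inr (hDC.antisymm fun y hy => ?_)
      have hreach : (graphAt E p).Reachable x y :=
        SimpleGraph.ConnectedComponent.exact (((hmem x).1 (hDC hx)).trans ((hmem y).1 hy).symm)
      obtain ⟨walk⟩ := hreach
      clear hy
      induction walk with
      | nil => exact hx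
      | cons hadj _ ih => exact ih (hD.2 _ hx _ (Finset.mem_univ _) (graphAt_adj.1 hadj))
  · have h1 := excess_add_card_le c.connected_toSimpleGraph
    have h2 : c.toSimpleGraph.edgeSet.ncard ≤ edgeCount (presentEdges E p) C := by
      rw [edgeCount, ← Set.ncard_coe_finset]
      refine Set.ncard_le_ncard_of_injOn (Sym2.map Subtype.val) (fun e he => ?_)
        (Sym2.map.injective Subtype.val_injective).injOn (Finset.finite_toSet _)
      induction e with | h x y =>
      have hadj : (graphAt E p).Adj x y := he
      rw [Sym2.map_mk, Finset.mem_coe, Finset.mem_inter, mk_mem_edgesIn]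
      exact ⟨graphAt_adj.1 hadj, (hmem _).2 x.2, (hmem _).2 y.2, hadj.ne⟩
    have h3 : Nat.card c = C.card := by
      rw [hC, ← Set.ncard_eq_toFinset_card']
      rfl
    rw [h3] at h1
    have h4 : (excess c.toSimpleGraph : ℝ) + C.card ≤ edgeCount (presentEdges E p) C + 1 := by
      exact_mod_cast h1.trans (Nat.add_le_add_right h2 1)
    linarith

lemma edgeRate_pos {w : Fin n → ℝ} (hw : ∀ i, 0 < w i) (e : PotentialEdge n) :
    0 < edgeRate w e := by
  obtain ⟨e, he⟩ := e
  induction e with | h i j =>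
  exact mul_pos (hw i) (hw j)

lemma expMeasure_Iic {r p : ℝ} (hr : 0 < r) (hp : 0 ≤ p) :
    expMeasure r (Set.Iic p) = ENNReal.ofReal (1 - Real.exp (-(r * p))) := by
  have := isProbabilityMeasure_expMeasure hr
  rw [← ofReal_cdf, cdf_expMeasure_eq hr, if_pos hp]

lemma expMeasure_Ioi {r p : ℝ} (hr : 0 < r) (hp : 0 ≤ p) :
    expMeasure r (Set.Ioi p) = ENNReal.ofReal (1 - (1 - Real.exp (-(r * p)))) := by
  have := isProbabilityMeasure_expMeasure hr
  have h1 : 0 ≤ 1 - Real.exp (-(r * p)) := by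
    have : 0 ≤ r * p := by positivity
    simpa using this
  rw [← Set.compl_Iic, prob_compl_eq_one_sub measurableSet_Iic, expMeasure_Iic hr hp,
    ENNReal.ofReal_sub _ h1, ENNReal.ofReal_one]

lemma isProbabilityMeasure_capacityLaw {w : Fin n → ℝ} (hw : ∀ i, 0 < w i) :
    IsProbabilityMeasure (capacityLaw w) := by
  have := fun e => isProbabilityMeasure_expMeasure (edgeRate_pos hw e)
  unfold capacityLaw
  infer_instance

/-- Inclusion in a box is enough: only an upper bound is needed, and no event has to be shown
measurable. -/
lemma capacityLaw_presentEdges_le {w : Fin n → ℝ} (hw : ∀ i, 0 < w i) {p : ℝ} (hp : 0 ≤ p)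
    {S : Finset (Sym2 (Fin n))} (hS : S ⊆ edgesIn Finset.univ) :
    capacityLaw w {E | presentEdges E p = S} ≤
      ENNReal.ofReal ((∏ e ∈ S, edgeProb w p e) *
        ∏ e ∈ edgesIn Finset.univ \ S, (1 - edgeProb w p e)) := by
  classical
  have := fun e => isProbabilityMeasure_expMeasure (edgeRate_pos hw e)
  have hsub : {E | presentEdges E p = S} ⊆ Set.pi Set.univ
      (fun e : PotentialEdge n => if e.1 ∈ S then Set.Iic p else Set.Ioi p) := by
    rintro E rfl e -
    dsimp only
    by_cases he : E e ≤ p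
    · rw [if_pos (mem_presentEdges.2 ⟨e.2, he⟩)]; exact he
    · rw [if_neg fun h => he (mem_presentEdges.1 h).2]; exact not_le.1 he
  refine (measure_mono hsub).trans ?_
  rw [capacityLaw, Measure.pi_pi]
  have h1 : ∀ e : PotentialEdge n, expMeasure (edgeRate w e)
      (if e.1 ∈ S then Set.Iic p else Set.Ioi p) =
      ENNReal.ofReal (if e.1 ∈ S then edgeProb w p e.1 else 1 - edgeProb w p e.1) := by
    intro e
    split_ifs
    · exact expMeasure_Iic (edgeRate_pos hw e) hp
    · exact expMeasure_Ioi (edgeRate_pos hw e) hp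
  simp only [h1]
  rw [← ENNReal.ofReal_prod_of_nonneg fun e _ => by
    split_ifs
    · exact edgeProb_nonneg hw hp _
    · exact sub_nonneg.2 (edgeProb_le_one _)]
  refine ENNReal.ofReal_le_ofReal (le_of_eq ?_)
  rw [← Finset.prod_subtype (edgesIn (Finset.univ : Finset (Fin n)))
    (fun e => by simp [edgesIn]) (fun e => if e ∈ S then edgeProb w p e else 1 - edgeProb w p e),
    ← Finset.prod_sdiff hS, mul_comm]
  congr 1
  · exact Finset.prod_congr rfl fun e he => if_pos he
  · exact Finset.prod_congr rfl fun e he => if_neg (Finset.mem_sdiff.1 he).2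

lemma capacityLaw_hasExcess_le {w : Fin n → ℝ} (hw : ∀ i, 0 < w i) {p : ℝ} (hp : 0 ≤ p) (k : ℝ) :
    capacityLaw w {E | HasExcess (presentEdges E p) Finset.univ k} ≤
      ENNReal.ofReal (gexp w p Finset.univ fun S => ind (HasExcess S Finset.univ k)) := by
  classical
  set A := (edgesIn (Finset.univ : Finset (Fin n))).powerset with hA
  have hsub : {E | HasExcess (presentEdges E p) Finset.univ k} ⊆
      ⋃ S ∈ A.filter fun S => HasExcess S Finset.univ k, {E | presentEdges E p = S} := by
    intro E hE
    simp only [Set.mem_iUnion]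
    refine ⟨presentEdges E p, Finset.mem_filter.2 ⟨Finset.mem_powerset.2 fun e he => ?_, hE⟩, rfl⟩
    simp [edgesIn, (mem_presentEdges.1 he).1]
  refine (measure_mono hsub).trans ((measure_biUnion_finset_le _ _).trans ?_)
  have hnn := fun S => bexp_weight_nonneg (A := edgesIn (Finset.univ : Finset (Fin n)))
    (edgeProb_nonneg hw hp) edgeProb_le_one S
  calc _ ≤ ∑ S ∈ A.filter (fun S => HasExcess S Finset.univ k),
        ENNReal.ofReal ((∏ e ∈ S, edgeProb w p e) *
          ∏ e ∈ edgesIn Finset.univ \ S, (1 - edgeProb w p e)) :=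
        Finset.sum_le_sum fun S hS => capacityLaw_presentEdges_le hw hp
          (Finset.mem_powerset.1 (Finset.mem_filter.1 hS).1)
    _ = ENNReal.ofReal (gexp w p Finset.univ fun S => ind (HasExcess S Finset.univ k)) := by
        rw [← ENNReal.ofReal_sum_of_nonneg fun S _ => hnn S, Finset.sum_filter]
        congr 1
        refine Finset.sum_congr rfl fun S _ => ?_
        dsimp only
        split_ifs with h
        · rw [ind_of_true h, mul_one]
        · rw [ind_of_false h, mul_zero]

end Capacities

/-! ### Asymptotics of the weights -/

section Asymptotics

/-- The truncated cube. -/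
def truncCube : ℝ →ᵇ ℝ :=
  BoundedContinuousFunction.ofNormedAddCommGroup (fun x => min (max x 0) 1 ^ 3) (by fun_prop) 1
    fun x => by
      have h0 : 0 ≤ min (max x 0) 1 := le_min (le_max_right _ _) zero_le_one
      rw [Real.norm_of_nonneg (pow_nonneg h0 3)]
      exact pow_le_one₀ h0 (min_le_right _ _)

lemma truncCube_apply (x : ℝ) : truncCube x = min (max x 0) 1 ^ 3 := rfl

lemma integral_pos_of_ae_pos {μ : Measure ℝ} [IsProbabilityMeasure μ] {g : ℝ → ℝ}
    (hg : Integrable g μ) (h : ∀ᵐ x ∂μ, 0 < g x) : 0 < ∫ x, g x ∂μ := by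
  rw [integral_pos_iff_support_of_nonneg_ae (h.mono fun x hx => hx.le) hg]
  have : μ (Function.support g) = 1 :=
    (prob_compl_eq_zero_iff₀ (hg.aestronglyMeasurable.nullMeasurableSet_support)).1
      (by filter_upwards [h] with x hx using hx.ne')
  rw [this]
  exact one_pos

namespace WeightConditions

variable {μ : Measure ℝ} {w : (n : ℕ) → Fin n → ℝ}

lemma integral_cube_nonneg (h : WeightConditions μ w) : 0 ≤ ∫ x, x ^ 3 ∂μ :=
  integral_nonneg_of_ae (h.law_pos.mono fun _ hx => pow_nonneg hx.le 3)

lemma tendsto_totalWeight_div (h : WeightConditions μ w) :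
    Tendsto (fun n : ℕ => totalWeight (w n) / n) atTop (𝓝 (∫ x, x ∂μ)) := by
  have h1 : (fun n : ℕ => (n : ℝ) ^ (2 / 3 : ℝ)) =O[atTop] fun n : ℕ => (n : ℝ) := by
    refine IsBigO.of_bound 1 ?_
    filter_upwards [eventually_ge_atTop 1] with n hn
    have hn1 : (1 : ℝ) ≤ n := by exact_mod_cast hn
    rw [Real.norm_of_nonneg (by positivity), Real.norm_of_nonneg (by positivity), one_mul]
    exact Real.rpow_le_self_of_one_le hn1 (by norm_num)
  have h2 := (h.sum_weight.trans_isBigO h1).tendsto_div_nhds_zero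
  have h3 := h2.add_const (∫ x, x ∂μ)
  rw [zero_add] at h3
  refine h3.congr' ?_
  filter_upwards [eventually_ge_atTop 1] with n hn
  have hn1 : (n : ℝ) ≠ 0 := by positivity
  field_simp
  ring

variable [IsProbabilityMeasure μ]

lemma integral_id_pos (h : WeightConditions μ w) : 0 < ∫ x, x ∂μ := by
  refine integral_pos_of_ae_pos ?_ h.law_pos
  refine ((integrable_const (1 : ℝ)).add h.integrable_cube.norm).mono'
    aestronglyMeasurable_id (Eventually.of_forall fun x => ?_)
  simp only [Pi.add_apply, norm_pow]
  have := norm_nonneg x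
  rcases le_total ‖x‖ 1 with h1 | h1
  · have := pow_nonneg this 3
    linarith
  · linarith [le_self_pow₀ h1 (n := 3) (by norm_num)]

lemma integral_truncCube_pos (h : WeightConditions μ w) : 0 < ∫ x, truncCube x ∂μ := by
  refine integral_pos_of_ae_pos (truncCube.integrable μ) ?_
  filter_upwards [h.law_pos] with x hx
  rw [truncCube_apply]
  exact pow_pos (lt_min (lt_max_of_lt_left hx) one_pos) 3

lemma eventually_totalWeight (h : WeightConditions μ w) :
    ∀ᶠ n : ℕ in atTop, (∫ x, x ∂μ) / 2 * n ≤ totalWeight (w n) ∧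
      totalWeight (w n) ≤ 2 * (∫ x, x ∂μ) * n := by
  have hm := h.integral_id_pos
  filter_upwards [h.tendsto_totalWeight_div.eventually_const_le (half_lt_self hm),
    h.tendsto_totalWeight_div.eventually_le_const (by linarith : ∫ x, x ∂μ < 2 * ∫ x, x ∂μ),
    eventually_ge_atTop 1] with n h1 h2 hn
  have hn1 : (0 : ℝ) < n := by exact_mod_cast hn
  exact ⟨(le_div_iff₀ hn1).1 h1, (div_le_iff₀ hn1).1 h2⟩

lemma rpow_isBigO (h : WeightConditions μ w) {a : ℝ} (ha : 0 ≤ a) :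
    (fun n : ℕ => (n : ℝ) ^ a) =O[atTop] fun n => totalWeight (w n) ^ a := by
  have hm := h.integral_id_pos
  refine IsBigO.of_bound ((2 / ∫ x, x ∂μ) ^ a) ?_
  filter_upwards [h.eventually_totalWeight] with n hn
  have h0 : 0 ≤ totalWeight (w n) := le_trans (by positivity) hn.1
  rw [Real.norm_of_nonneg (by positivity), Real.norm_of_nonneg (by positivity),
    ← Real.mul_rpow (by positivity) h0]
  refine Real.rpow_le_rpow (by positivity) ?_ ha
  rw [div_mul_eq_mul_div, le_div_iff₀ hm]
  linarith [hn.1]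

lemma tendsto_totalWeight (h : WeightConditions μ w) :
    Tendsto (fun n => totalWeight (w n)) atTop atTop := by
  refine tendsto_atTop_mono' _ (h.eventually_totalWeight.mono fun n hn => hn.1) ?_
  exact tendsto_natCast_atTop_atTop.const_mul_atTop (half_pos h.integral_id_pos)

/-- The weights eventually lie in the critical window. -/
lemma eventually_criticalWindow (h : WeightConditions μ w) {f : ℕ → ℝ} (hf0 : ∀ n, 0 < f n)
    (hf : f =o[atTop] fun n : ℕ => (n : ℝ) ^ (1 / 3 : ℝ)) {κ c₀ : ℝ}
    (hκ : κ = 2 * (∫ x, x ^ 3 ∂μ + 1) / ∫ x, x ∂μ)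
    (hc₀ : c₀ = (∫ x, truncCube x ∂μ) / (4 * ∫ x, x ∂μ)) :
    ∀ᶠ n in atTop, 1 ≤ f n → 8 * κ ≤ f n → ∃ ε,
      CriticalWindow (w n) (critParam (w n) (f n)) ε (f n) κ c₀ ∧
      (400 / c₀ + 1) * (f n * ε) ^ 2 ≤ 1 := by
  have hm := h.integral_id_pos
  have hg := h.integral_truncCube_pos
  have hc : 0 < c₀ := by rw [hc₀]; positivity
  have hκ0 : 0 < κ := by have := h.integral_cube_nonneg; rw [hκ]; positivity
  set x : ℕ → ℝ := fun n => totalWeight (w n) ^ (1 / 3 : ℝ) with hx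
  have hxt : Tendsto x atTop atTop :=
    (tendsto_rpow_atTop (by norm_num)).comp h.tendsto_totalWeight
  have hO1 : (fun n : ℕ => (n : ℝ) ^ (1 / 3 : ℝ)) =O[atTop] x := h.rpow_isBigO (by norm_num)
  have hO2 := h.rpow_isBigO (a := 2 / 3) (by norm_num)
  have hL0 : (0 : ℝ) < 400 / c₀ + 1 := by positivity
  -- δ will bound fε and η below will bound εw_i; both tend to 0 because f and the maximal weight
  -- are o(n^(1/3)).
  obtain ⟨δ, hδ0, hδ1, hδ2, hδ3⟩ : ∃ δ : ℝ, 0 < δ ∧ δ ≤ 1 ∧ 10 * δ ≤ c₀ ∧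
      (400 / c₀ + 1) * δ ^ 2 ≤ 1 := by
    refine ⟨min 1 (min (c₀ / 10) (1 / (400 / c₀ + 1))), by positivity, min_le_left _ _, ?_, ?_⟩
    · have : min 1 (min (c₀ / 10) (1 / (400 / c₀ + 1))) ≤ c₀ / 10 :=
        (min_le_right _ _).trans (min_le_left _ _)
      linarith
    · set δ := min 1 (min (c₀ / 10) (1 / (400 / c₀ + 1)))
      have h1 : δ ≤ 1 := min_le_left _ _
      have h2 : δ ≤ 1 / (400 / c₀ + 1) := (min_le_right _ _).trans (min_le_right _ _)
      have h3 : 0 ≤ δ := by positivity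
      rw [le_div_iff₀' hL0] at h2
      nlinarith
  obtain ⟨η, hη0, hη1, hη2⟩ : ∃ η : ℝ, 0 < η ∧ η ≤ 1 / 10 ∧ 640 * η ^ 2 ≤ c₀ := by
    refine ⟨min (1 / 10) (c₀ / 640), by positivity, min_le_left _ _, ?_⟩
    set η := min (1 / 10) (c₀ / 640)
    have h1 : η ≤ 1 / 10 := min_le_left _ _
    have h2 : η ≤ c₀ / 640 := min_le_right _ _
    have h3 : 0 ≤ η := by positivity
    nlinarith
  -- Criticality: the terms linear in n cancel because the first two moments of W agree.
  have hsq : (fun n : ℕ => ∑ i, w n i ^ 2 - totalWeight (w n)) =o[atTop]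
      fun n => totalWeight (w n) ^ (2 / 3 : ℝ) := by
    have := (h.sum_weight_sq.sub h.sum_weight).trans_isBigO hO2
    refine this.congr_left fun n => ?_
    rw [h.second_moment_eq]
    ring
  filter_upwards [h.eventually_totalWeight, hxt.eventually_ge_atTop 10, eventually_ge_atTop 1,
    (hf.trans_isBigO hO1).def hδ0, (h.max_weight.trans_isBigO hO1).def hη0, hsq.def one_pos,
    h.sum_weight_cube.def one_pos,
    (h.tendsto_law truncCube).eventually_const_le (half_lt_self hg)]
    with n hl hx10 hn hfx hmax hsq hcube htr hf1 hfκ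
  have hn1 : (0 : ℝ) < n := by exact_mod_cast hn
  set l := totalWeight (w n) with hl'
  have hl0 : 0 < l := lt_of_lt_of_le (by positivity) hl.1
  have hx0 : 0 < x n := by linarith
  have hx3 : x n ^ 3 = l := by
    rw [hx, ← Real.rpow_natCast, ← Real.rpow_mul hl0.le]; norm_num
  have hx2 : l ^ (2 / 3 : ℝ) = x n ^ 2 := by
    rw [hx, ← Real.rpow_natCast, ← Real.rpow_mul hl0.le]; norm_num
  have hx4 : l ^ (4 / 3 : ℝ) = x n ^ 4 := by
    rw [hx, ← Real.rpow_natCast, ← Real.rpow_mul hl0.le]; norm_num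
  have hp : critParam (w n) (f n) = (x n)⁻¹ ^ 3 * (1 + f n * (x n)⁻¹) := by
    have : critParam (w n) (f n) = (x n + f n) / x n ^ 4 := by rw [← hx4]; rfl
    rw [this]; field_simp
  have hfε : f n * (x n)⁻¹ ≤ δ := by
    rw [Real.norm_of_nonneg (hf0 n).le, Real.norm_of_nonneg hx0.le] at hfx
    rwa [← div_eq_mul_inv, div_le_iff₀ hx0]
  have hfε0 : 0 ≤ f n * (x n)⁻¹ := mul_nonneg (hf0 n).le (inv_nonneg.2 hx0.le)
  have hwmax : ∀ i, (x n)⁻¹ * w n i ≤ η := by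
    intro i
    have h1 : w n i ≤ ⨆ i, w n i := le_ciSup (Set.finite_range _).bddAbove i
    have h2 := (le_abs_self _).trans hmax
    rw [Real.norm_of_nonneg hx0.le] at h2
    rw [inv_mul_le_iff₀ hx0]
    linarith
  have hwmax0 : ∀ i, 0 ≤ (x n)⁻¹ * w n i := fun i =>
    mul_nonneg (inv_nonneg.2 hx0.le) (h.weight_pos n i).le
  have hε3 : (x n)⁻¹ ^ 3 = l⁻¹ := by rw [inv_pow, hx3]
  refine ⟨(x n)⁻¹, ⟨h.weight_pos n, inv_pos.2 hx0, ?_, hf1, hκ0, hfκ, hc, hfε.trans hδ1, ?_, hp,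
    ?_, ?_, ?_, ?_, fun i => (hwmax i).trans hη1, fun i => ?_⟩, ?_⟩
  · rw [inv_eq_one_div]
    exact one_div_le_one_div_of_le (by norm_num) hx10
  · linarith
  · rw [hε3]; exact inv_mul_cancel₀ hl0.ne'
  · rw [hε3, inv_mul_le_iff₀ hl0]
    have h1 := (le_abs_self _).trans hsq
    rw [one_mul, hx2, Real.norm_of_nonneg (by positivity)] at h1
    have h2 : l * (x n)⁻¹ = x n ^ 2 := by rw [← hx3]; field_simp
    linarith
  · rw [hε3, inv_mul_le_iff₀ hl0]
    have h1 := (le_abs_self _).trans hcube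
    rw [one_mul, Real.norm_of_nonneg hn1.le] at h1
    have h3 := h.integral_cube_nonneg
    calc ∑ i, w n i ^ 3 ≤ (∫ x, x ^ 3 ∂μ + 1) * n := by linarith
      _ = (∫ x, x ∂μ) / 2 * n * κ := by rw [hκ]; field_simp
      _ ≤ l * κ := mul_le_mul_of_nonneg_right hl.1 hκ0.le
  · rw [hε3, ← div_eq_inv_mul, le_div_iff₀ hl0]
    have h1 : ∀ i, truncCube (w n i) = min (w n i) 1 ^ 3 := fun i => by
      rw [truncCube_apply, max_eq_left (h.weight_pos n i).le]
    simp only [h1] at htr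
    rw [le_div_iff₀ hn1] at htr
    -- The 4 in c₀ pays for ℓ ≤ 2 E[W] n and for halving the limit of the truncated average.
    calc c₀ * l ≤ c₀ * (2 * (∫ x, x ∂μ) * n) := mul_le_mul_of_nonneg_left hl.2 hc.le
      _ = (∫ x, truncCube x ∂μ) / 2 * n := by rw [hc₀]; field_simp; norm_num
      _ ≤ _ := htr
  · calc 640 * ((x n)⁻¹ * w n i) ^ 2 ≤ 640 * η ^ 2 := by
          have := hwmax i
          have := hwmax0 i
          gcongr
      _ ≤ c₀ := hη2
  · calc _ ≤ (400 / c₀ + 1) * δ ^ 2 := by gcongr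
      _ ≤ 1 := hδ3

end WeightConditions
end Asymptotics

end

end RankOneGraph

/-! ### Choice of the constant and conclusion. -/

theorem mainTheorem2 (μ : MeasureTheory.Measure ℝ) [MeasureTheory.IsProbabilityMeasure μ] :
    ∃ A : ℝ, 0 < A ∧
      ∀ w : (n : ℕ) → Fin n → ℝ, RankOneGraph.WeightConditions μ w →
      ∀ f : ℕ → ℝ, (∀ n, 0 < f n) →
        (f =o[Filter.atTop] fun n : ℕ => (n : ℝ) ^ (1 / 3 : ℝ)) →
      ∀ᶠ n in Filter.atTop,
        RankOneGraph.capacityLaw (w n)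
            {E | ∃ c : (RankOneGraph.graphAt E
                  (RankOneGraph.critParam (w n) (f n))).ConnectedComponent,
                RankOneGraph.IsLargest c ∧
                A * f n ^ 3 ≤ (RankOneGraph.excess c.toSimpleGraph : ℝ)}
          ≤ ENNReal.ofReal (A * Real.exp (-f n / A)) := by
  set κ := 2 * (∫ x, x ^ 3 ∂μ + 1) / ∫ x, x ∂μ with hκ
  set c₀ := (∫ x, RankOneGraph.truncCube x ∂μ) / (4 * ∫ x, x ∂μ) with hc₀
  set F := max 1 (8 * κ) with hF
  set D := 4 * (2 * (400 / c₀) + 20) ^ 2 with hD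
  have hD0 : 0 ≤ D := by positivity
  have hexpF := Real.exp_pos F
  -- 61 is the prefactor and D the threshold in `gexp_hasExcess_univ_le`; exp F makes the claimed
  -- bound at least 1 for f < F, where that estimate is not used.
  refine ⟨61 + Real.exp F + D, by positivity, fun w hw f hf0 hf => ?_⟩
  set A := 61 + Real.exp F + D with hA
  have hA0 : 0 < A := by positivity
  filter_upwards [hw.eventually_criticalWindow hf0 hf hκ hc₀] with n hn
  have := RankOneGraph.isProbabilityMeasure_capacityLaw (hw.weight_pos n)
  have hdiv : f n / A ≤ f n := div_le_self (hf0 n).le (by linarith)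
  by_cases hfn : F ≤ f n
  · obtain ⟨ε, hcw, hsmall⟩ := hn ((le_max_left _ _).trans hfn) ((le_max_right _ _).trans hfn)
    have hf3 : 0 < f n ^ 3 := pow_pos (hf0 n) 3
    refine (measure_mono ?_).trans ((RankOneGraph.capacityLaw_hasExcess_le (hw.weight_pos n)
      hcw.p_pos.le (A * f n ^ 3)).trans (ENNReal.ofReal_le_ofReal ?_))
    · rintro E ⟨c, -, hc⟩
      exact RankOneGraph.hasExcess_presentEdges c hc
    · refine (hcw.gexp_hasExcess_univ_le hsmall ?_).trans ?_
      · exact mul_le_mul_of_nonneg_right (by linarith) hf3.le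
      · refine mul_le_mul (by linarith) (Real.exp_le_exp.2 ?_) (Real.exp_pos _).le hA0.le
        rw [neg_div]
        linarith
  · refine prob_le_one.trans ?_
    rw [ENNReal.one_le_ofReal]
    calc (1 : ℝ) = Real.exp F * Real.exp (-F) := by rw [← Real.exp_add]; simp
      _ ≤ A * Real.exp (-f n / A) := by
        refine mul_le_mul (by linarith) (Real.exp_le_exp.2 ?_) (Real.exp_pos _).le hA0.le
        rw [neg_div]
        linarith
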